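/- **Setting.** In an $N$-player normal-form game, player $i$ has a finite set $\mathcal A_i$ of $K_i$ actions and a utility $u_i:\mathcal A_1\times\dots\times\mathcal A_N\to[0,1]$. Write $\Delta(\mathcal A_i)$ for the set of mixed strategies of player $i$. For $\Delta>0$ put $E_0=\emptyset$ and, for $l\ge 1$, $$E_l=\bigcup_{i=1}^N\{a\in\mathcal A_i:\ \exists x\in\Delta(\mathcal A_i)\ \forall a_{-i}\text{ with } a_{-i}\cap E_{l-1}=\emptyset:\ u_i(a,a_{-i})\le u_i(x,a_{-i})-\Delta\}.$$ Let $L=\inf\{l\ge 1: E_{l+1}=E_l\}$ be the minimum elimination length. An action profile is $\Delta$-rationalizable if none of its actions belongs to $E_L$. A game with bandit feedback consists of a game and, for each profile $a$, a law of a feedback vector $(U_1,\dots,U_N)\in[0,1]^N$ with $\mathbb E[U_i\mid a]=u_i(a)$ for all $i$. A (possibly randomized) algorithm adaptively chooses, on the basis of its own randomness and of the profiles played and the feedback vectors observed so far, either to play a profile, which costs one sample and reveals a fresh feedback vector, or to stop and output a profile. An algorithm that never stops is not successful and uses infinitely many samples. **Theorem.** 1. (Lower bound.) There is a universal constant $c>0$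 such that for all $N\ge1$, $A\ge2$ and $0<\Delta<1/10$ there is a family $\mathcal F$ of $N$-player games with bandit feedback, with $A$ actions per player and with minimum elimination length $L\le 2$, and a member $G_0\in\mathcal F$, such that the following holds. Every algorithm that on each game of $\mathcal F$ outputs a $\Delta$-rationalizable action profile with probability at least $0.9$ uses, on $G_0$, at least $c\,NA/\Delta^2$ samples in expectation. 2. (The bound is tight up to logarithmic factors when $L=O(1)$.) There is a universal constant $C>0$ such that for all $N,A,L\ge1$, all $K_1,\dots,K_N\in\{1,\dots,A\}$, all $\Delta>0$ and all $\delta\in(0,1)$ there is an algorithm that always uses at most $$C\,\frac{LNA}{\Delta^2}\,\log\frac{2LNA}{\delta}$$ samples and that, on every game with bandit feedback in which player $i$ has $K_i$ actions for each $i$ and whose minimum elimination length is at most $L$, outputs a $\Delta$-rationalizable action profile with probability at least $1-\delta$. -/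

import Mathlib

open MeasureTheory ProbabilityTheory
open scoped ENNReal

noncomputable section

/-- Pure action profiles of an `N`-player game in which player `i` has `K i` actions. -/
abbrev Profile {N : ℕ} (K : Fin N → ℕ) : Type := ∀ i, Fin (K i)

/-- An `N`-player normal-form game with utilities in `[0,1]`. -/
structure Game {N : ℕ} (K : Fin N → ℕ) where
  u : Fin N → Profile K → ℝ
  u_mem : ∀ i a, u i a ∈ Set.Icc (0 : ℝ) 1

namespace Game

variable {N : ℕ} {K : Fin N → ℕ}

/-- `u_i(x, a_{-i})`, where player `i` plays the mixed strategy `x`. The `i`-th coordinate of `a`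
is ignored. -/
def mixedU (G : Game K) (i : Fin N) (x : Fin (K i) → ℝ) (a : Profile K) : ℝ :=
  ∑ b, x b * G.u i (Function.update a i b)

/-- The set `E_l` of actions (of all players) eliminated by the `l`-th round of iterative
elimination of `Δ`-dominated actions, with `E_0 = ∅`. An action is a pair `⟨i, b⟩` of a player and
an action of that player. -/
def elim (G : Game K) (Δ : ℝ) : ℕ → Set (Σ i, Fin (K i))
  | 0 => ∅
  | l + 1 => {p | ∃ x ∈ stdSimplex ℝ (Fin (K p.1)), ∀ a : Profile K,
      (∀ j, j ≠ p.1 → (⟨j, a j⟩ : Σ i, Fin (K i)) ∉ elim G Δ l) →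
        G.u p.1 (Function.update a p.1 p.2) ≤ G.mixedU p.1 x a - Δ}

/-- The minimum elimination length `L = inf {l ≥ 1 : E_{l+1} = E_l}`. -/
def elimLength (G : Game K) (Δ : ℝ) : ℕ :=
  sInf {l | 1 ≤ l ∧ G.elim Δ (l + 1) = G.elim Δ l}

/-- A profile is `Δ`-rationalizable if none of its actions lies in `E_L`. -/
def RationalizableProfile (G : Game K) (Δ : ℝ) (a : Profile K) : Prop :=
  ∀ i, (⟨i, a i⟩ : Σ i, Fin (K i)) ∉ G.elim Δ (G.elimLength Δ)

end Game

/-- The random feedback of all players in one round. -/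
abbrev Payoffs (N : ℕ) : Type := Fin N → Set.Icc (0 : ℝ) 1

/-- A normal-form game with bandit feedback: when the profile `a` is played, a random vector
`U ∈ [0,1]^N` of law `law a` is observed, and `E[U_i | a] = u_i(a)`. -/
structure BanditGame {N : ℕ} (K : Fin N → ℕ) extends Game K where
  law : Profile K → Measure (Payoffs N)
  isProbabilityMeasure_law : ∀ a, IsProbabilityMeasure (law a)
  mean_law : ∀ a i, ∫ U, ((U i : Set.Icc (0 : ℝ) 1) : ℝ) ∂(law a) = u i a

attribute [instance] BanditGame.isProbabilityMeasure_law

/-- What is observed in the first `n` rounds: the profiles played and the feedback received. -/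
abbrev Hist {N : ℕ} (K : Fin N → ℕ) (n : ℕ) : Type := Fin n → Profile K × Payoffs N

/-- An adaptive, randomized (and possibly centralized) learning algorithm: a private random seed, a
sampling rule, a stopping rule and a recommendation rule, each of which depends only on the seed
and on the history observed so far. -/
structure Algorithm {N : ℕ} (K : Fin N → ℕ) where
  Seed : Type
  [instSeed : MeasurableSpace Seed]
  seedLaw : Measure Seed
  [isProbabilityMeasure_seedLaw : IsProbabilityMeasure seedLaw]
  /-- the profile to play next after `n` rounds -/
  sample : ∀ n, Seed × Hist K n → Profile K
  /-- the seeds and histories at which the algorithm stops after `n` rounds -/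
  halt : ∀ n, Set (Seed × Hist K n)
  /-- the profile that is output if the algorithm stops after `n` rounds -/
  recommend : ∀ n, Seed × Hist K n → Profile K
  measurable_sample : ∀ n, Measurable (sample n)
  measurableSet_halt : ∀ n, MeasurableSet (halt n)
  measurable_recommend : ∀ n, Measurable (recommend n)

attribute [instance] Algorithm.instSeed Algorithm.isProbabilityMeasure_seedLaw

/-- A table of feedback: the entry `T n a` is the feedback that is observed if `a` is the profile
played in round `n`. -/
abbrev FeedbackTable {N : ℕ} (K : Fin N → ℕ) : Type := ℕ → Profile K → Payoffs N

/-- The law of the feedback table of `G`: its entries are independent, and `T n a` has law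
`G.law a`. Only one entry of each row is ever observed. -/
def BanditGame.tableLaw {N : ℕ} {K : Fin N → ℕ} (G : BanditGame K) : Measure (FeedbackTable K) :=
  Measure.infinitePi (fun _ : ℕ => Measure.pi (fun a : Profile K => G.law a))

namespace Algorithm

variable {N : ℕ} {K : Fin N → ℕ}

/-- The seed and the history of the first `n` rounds (if the stopping rule is disregarded). -/
def seedHist (alg : Algorithm K) (ω : alg.Seed × FeedbackTable K) : ∀ n, alg.Seed × Hist K n
  | 0 => (ω.1, Fin.elim0)
  | n + 1 =>
    let a := alg.sample n (alg.seedHist ω n)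
    (ω.1, Fin.snoc (α := fun _ => Profile K × Payoffs N) (alg.seedHist ω n).2 (a, ω.2 n a))

/-- The algorithm stops after exactly `n` rounds. -/
def StopsAt (alg : Algorithm K) (ω : alg.Seed × FeedbackTable K) (n : ℕ) : Prop :=
  alg.seedHist ω n ∈ alg.halt n ∧ ∀ m < n, alg.seedHist ω m ∉ alg.halt m

/-- The number of samples (rounds played) until the algorithm stops; `∞` if it never stops. -/
def numSamples (alg : Algorithm K) (ω : alg.Seed × FeedbackTable K) : ℝ≥0∞ :=
  ⨅ (n : ℕ) (_ : alg.StopsAt ω n), (n : ℝ≥0∞)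

/-- The probability space on which the algorithm runs on `G`: seed and feedback table are
independent. -/
def runLaw (alg : Algorithm K) (G : BanditGame K) : Measure (alg.Seed × FeedbackTable K) :=
  alg.seedLaw.prod G.tableLaw

/-- The expected number of samples that the algorithm uses on `G`. -/
def expectedSamples (alg : Algorithm K) (G : BanditGame K) : ℝ≥0∞ :=
  ∫⁻ ω, alg.numSamples ω ∂(alg.runLaw G)

/-- The probability that the algorithm, run on `G`, stops and outputs a `Δ`-rationalizable
profile. -/
def successProb (alg : Algorithm K) (G : BanditGame K) (Δ : ℝ) : ℝ :=
  (alg.runLaw G).real {ω | ∃ n, alg.StopsAt ω n ∧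
    G.RationalizableProfile Δ (alg.recommend n (alg.seedHist ω n))}

end Algorithm

end

/-! Lower bound. In the base game action `0` beats every other action by `Δ` whatever the others do,
so the zero profile is the only rationalizable one. For each of the `N * (A - 1)` unilateral
deviations `(i, b)` from it, an alternative game raises the mean payoff of player `i` at that one
profile from `1/2 - 2Δ` to `1/2`. All other nonzero actions still fall in the first round; the
opponents are then confined to `0`, so the second round removes action `0` of player `i`. The
deviation profile is now the only rationalizable one (`hardGame_spec`). A correct algorithm must
tell each alternative from the base game, and the two differ only in one coin at one profile. A
second moment bound on the likelihood ratio, stopped while that profile has been played at most `k ≈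
1/(16Δ²)` times (`measure_outputs_playCount_le`), shows that in the base game it is played more
often with probability at least `1/5`. The deviation profiles are distinct, so their play counts add
up (`le_expectedSamples`).

Upper bound. Neither the sets `E_l` nor mixed dominators have to be estimated. Starting from any
profile, let every player repeatedly move to an approximate best response to the current profile. If
the current profile avoids `E_l`, a response losing less than `Δ` against it cannot be dominated on
all profiles avoiding `E_l`, since this very profile is a counterexample (`notMem_elim_succ`). After
`L` stages the profile avoids `E_L`. A stage needs each action's payoff against a single profile,
with accuracy `Δ/2`; Hoeffding's inequality for adaptive sampling and a union bound give the sample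
count.

Both halves rest on one tool: a product of weights along the history, each of conditional mean at
most `1`, has stopped expectation at most `1` (`tsum_lintegral_histProd_le`). The weights are
normalized squared likelihood ratios in the first half and exponential moments in the second. -/

/-! ### Resampling a row of the feedback table -/

section UpdateInfinitePi

lemma measurable_update_prod {X : Type*} [MeasurableSpace X] (n : ℕ) :
    Measurable fun p : (ℕ → X) × X => Function.update p.1 n p.2 := by
  refine measurable_pi_iff.2 fun i => ?_
  by_cases h : i = n
  · subst h; simpa using measurable_snd
  · simp only [Function.update_of_ne h]
    fun_prop

/-- Resampling one coordinate of an infinite product does not change its law. -/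
lemma map_update_infinitePi_prod {X : Type*} [MeasurableSpace X] (μ : ℕ → Measure X)
    [∀ i, IsProbabilityMeasure (μ i)] (n : ℕ) :
    ((Measure.infinitePi μ).prod (μ n)).map (fun p => Function.update p.1 n p.2) =
      Measure.infinitePi μ := by
  have hm := measurable_update_prod (X := X) n
  refine Measure.eq_infinitePi μ fun s t ht => ?_
  classical
  rw [Measure.map_apply hm (.pi s.countable_toSet fun i _ => ht i)]
  -- The preimage of a box is a box without its constraint at `n`, times that constraint on the
  -- fresh copy.
  have : (fun p : (ℕ → X) × X => Function.update p.1 n p.2) ⁻¹' (Set.pi s t) =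
      (Set.pi ((s.erase n : Finset ℕ) : Set ℕ) t) ×ˢ (if n ∈ s then t n else Set.univ) := by
    ext p
    simp only [Set.mem_preimage, Set.mem_pi, Set.mem_prod, Finset.mem_coe, Finset.mem_erase]
    constructor
    · intro h
      refine ⟨fun i hi => by simpa [Function.update_of_ne hi.1] using h i hi.2, ?_⟩
      split_ifs with hn
      · simpa using h n hn
      · trivial
    · rintro ⟨h1, h2⟩ i hi
      by_cases hin : i = n
      · subst hin; simpa [hi] using h2
      · simpa [Function.update_of_ne hin] using h1 i ⟨hin, hi⟩
  rw [this, Measure.prod_prod, Measure.infinitePi_pi μ fun i _ => ht i]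
  split_ifs with hn
  · rw [mul_comm, Finset.mul_prod_erase s (fun i => μ i (t i)) hn]
  · simp [Finset.erase_eq_of_notMem hn]

end UpdateInfinitePi

/-! ### Law of the history and change of measure -/

namespace Algorithm

variable {N : ℕ} {K : Fin N → ℕ}

instance (G : BanditGame K) : IsProbabilityMeasure G.tableLaw := by
  unfold BanditGame.tableLaw; infer_instance

instance (alg : Algorithm K) (G : BanditGame K) : IsProbabilityMeasure (alg.runLaw G) := by
  unfold Algorithm.runLaw; infer_instance

lemma measurable_extend {S : Type*} [MeasurableSpace S] (n : ℕ) :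
    Measurable fun p : (S × Hist K n) × (Profile K × Payoffs N) =>
      ((p.1.1, Fin.snoc (α := fun _ => Profile K × Payoffs N) p.1.2 p.2) : S × Hist K (n + 1)) := by
  refine (measurable_fst.comp measurable_fst).prodMk (measurable_pi_iff.2 fun i => ?_)
  refine Fin.lastCases ?_ (fun j => ?_) i
  · simpa using measurable_snd
  · simp only [Fin.snoc_castSucc]
    fun_prop

lemma measurable_init {S : Type*} [MeasurableSpace S] (n : ℕ) :
    Measurable fun p : S × Hist K (n + 1) => ((p.1, Fin.init p.2) : S × Hist K n) := by
  refine measurable_fst.prodMk (measurable_pi_iff.2 fun i => ?_)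
  simp only [Fin.init]
  fun_prop

lemma measurable_entry : Measurable fun p : Profile K × (Profile K → Payoffs N) => p.2 p.1 :=
  measurable_from_prod_countable_right fun a => measurable_pi_apply a

variable (alg : Algorithm K)

lemma seedHist_succ (ω : alg.Seed × FeedbackTable K) (n : ℕ) :
    alg.seedHist ω (n + 1) = ((alg.seedHist ω n).1,
      Fin.snoc (α := fun _ => Profile K × Payoffs N) (alg.seedHist ω n).2
        (alg.sample n (alg.seedHist ω n), ω.2 n (alg.sample n (alg.seedHist ω n)))) := by
  cases n <;> rfl

lemma init_seedHist_succ (ω : alg.Seed × FeedbackTable K) (n : ℕ) :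
    ((alg.seedHist ω (n + 1)).1, Fin.init (alg.seedHist ω (n + 1)).2) = alg.seedHist ω n := by
  rw [seedHist_succ]; simp

lemma measurable_seedHist (n : ℕ) : Measurable fun ω => alg.seedHist ω n := by
  induction n with
  | zero => 
    refine measurable_fst.prodMk (measurable_pi_iff.2 fun i => i.elim0)
  | succ n ih =>
    simp only [seedHist_succ]
    refine (measurable_extend n).comp (ih.prodMk ?_)
    have hs := (alg.measurable_sample n).comp ih
    exact hs.prodMk (measurable_entry.comp
      (hs.prodMk ((measurable_pi_apply n).comp measurable_snd)))

/-- The first `m` rounds read only rows `0, …, m - 1` of the table. This is what makes row `n`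
independent of the choice made in round `n`. -/
lemma seedHist_update (s : alg.Seed) (T : FeedbackTable K) (n : ℕ) (V : Profile K → Payoffs N)
    (m : ℕ) (hm : m ≤ n) : alg.seedHist (s, Function.update T n V) m = alg.seedHist (s, T) m := by
  induction m with
  | zero => rfl
  | succ m ih =>
    have : m ≠ n := by omega
    simp only [seedHist_succ, ih (by omega), Function.update_of_ne this]

/-- The law of the feedback as a Markov kernel. -/
noncomputable def lawKernel (G : BanditGame K) : Kernel (Profile K) (Payoffs N) :=
  ⟨G.law, measurable_of_countable _⟩

instance (G : BanditGame K) : IsMarkovKernel (lawKernel G) := ⟨G.isProbabilityMeasure_law⟩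

lemma measurable_lintegral_law (G : BanditGame K) {X : Type*} [MeasurableSpace X]
    {a : X → Profile K} (ha : Measurable a) {φ : X × Payoffs N → ℝ≥0∞} (hφ : Measurable φ) :
    Measurable fun x => ∫⁻ U, φ (x, U) ∂(G.law (a x)) :=
  Measurable.lintegral_kernel_prod_right' (κ := (lawKernel G).comap a ha) hφ

/-- Given the first `n` rounds, the feedback of the next round has the law of the profile played. -/
lemma lintegral_seedHist_succ (G : BanditGame K) (n : ℕ)
    {φ : alg.Seed × Hist K (n + 1) → ℝ≥0∞} (hφ : Measurable φ) :
    ∫⁻ ω, φ (alg.seedHist ω (n + 1)) ∂(alg.runLaw G) =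
      ∫⁻ ω, ∫⁻ U, φ ((alg.seedHist ω n).1,
        Fin.snoc (α := fun _ => Profile K × Payoffs N) (alg.seedHist ω n).2
          (alg.sample n (alg.seedHist ω n), U))
        ∂(G.law (alg.sample n (alg.seedHist ω n))) ∂(alg.runLaw G) := by
  set ρ := Measure.pi (fun a : Profile K => G.law a)
  have hφ1 : Measurable fun ω => φ (alg.seedHist ω (n + 1)) :=
    hφ.comp (alg.measurable_seedHist (n + 1))
  have hm := measurable_update_prod (X := Profile K → Payoffs N) n
  have hs := (alg.measurable_sample n).comp (alg.measurable_seedHist n)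
  have hψ : Measurable fun q : (alg.Seed × FeedbackTable K) × Payoffs N =>
      φ ((alg.seedHist q.1 n).1, Fin.snoc (α := fun _ => Profile K × Payoffs N)
        (alg.seedHist q.1 n).2 (alg.sample n (alg.seedHist q.1 n), q.2)) :=
    hφ.comp ((measurable_extend n).comp (((alg.measurable_seedHist n).comp measurable_fst).prodMk
      ((hs.comp measurable_fst).prodMk measurable_snd)))
  have hψ2 : Measurable fun ω => ∫⁻ U, φ ((alg.seedHist ω n).1,
      Fin.snoc (α := fun _ => Profile K × Payoffs N) (alg.seedHist ω n).2
        (alg.sample n (alg.seedHist ω n), U)) ∂(G.law (alg.sample n (alg.seedHist ω n))) :=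
    measurable_lintegral_law G hs hψ
  unfold runLaw
  rw [lintegral_prod _ hφ1.aemeasurable, lintegral_prod _ hψ2.aemeasurable]
  refine lintegral_congr fun s => ?_
  -- Row `n` is replaced by a fresh copy `V`. The past does not see it, so the inner integral over
  -- `V` acts as the conditional expectation, and only the entry of the profile played matters.
  have h1 : ∫⁻ T, φ (alg.seedHist (s, T) (n + 1)) ∂G.tableLaw =
      ∫⁻ T, ∫⁻ V, φ (alg.seedHist (s, Function.update T n V) (n + 1)) ∂ρ ∂G.tableLaw := by
    have h2 : Measurable fun T => φ (alg.seedHist (s, T) (n + 1)) :=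
      hφ1.comp measurable_prodMk_left
    rw [← lintegral_prod (fun p : FeedbackTable K × (Profile K → Payoffs N) =>
      φ (alg.seedHist (s, Function.update p.1 n p.2) (n + 1))) (h2.comp hm).aemeasurable,
      ← lintegral_map h2 hm]
    congr 1
    exact (map_update_infinitePi_prod (fun _ => ρ) n).symm
  rw [h1]
  refine lintegral_congr fun T => ?_
  simp only [seedHist_succ _ _ n, seedHist_update _ _ _ _ _ _ le_rfl, Function.update_self]
  have h3 : Measurable fun U => φ ((alg.seedHist (s, T) n).1,
      Fin.snoc (α := fun _ => Profile K × Payoffs N) (alg.seedHist (s, T) n).2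
        (alg.sample n (alg.seedHist (s, T) n), U)) := hψ.comp measurable_prodMk_left
  exact (measurePreserving_eval (fun a : Profile K => G.law a)
    (alg.sample n (alg.seedHist (s, T) n))).lintegral_comp h3

/-- The product of a time-dependent weight along a history. -/
noncomputable def histProd (g : ℕ → Profile K × Payoffs N → ℝ≥0∞) (n : ℕ) (h : Hist K n) : ℝ≥0∞ :=
  ∏ t : Fin n, g t (h t)

lemma histProd_snoc (g : ℕ → Profile K × Payoffs N → ℝ≥0∞) (n : ℕ) (h : Hist K n)
    (x : Profile K × Payoffs N) :
    histProd g (n + 1) (Fin.snoc (α := fun _ => Profile K × Payoffs N) h x) =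
      histProd g n h * g n x := by
  simp [histProd, Fin.prod_univ_castSucc]

lemma measurable_histProd {g : ℕ → Profile K × Payoffs N → ℝ≥0∞} (hg : ∀ n, Measurable (g n))
    (n : ℕ) : Measurable (histProd g n) := by
  unfold histProd
  exact Finset.measurable_prod _ fun t _ => (hg t).comp (measurable_pi_apply t)

/-- Change of measure along the observed history: the likelihood ratio of two games is the product
of the likelihood ratios of the observed feedback. -/
lemma lintegral_change_of_measure (G₀ G₁ : BanditGame K)
    {g : ℕ → Profile K × Payoffs N → ℝ≥0∞} (hgm : ∀ n, Measurable (g n))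
    (hg : ∀ n a, ∀ φ : Payoffs N → ℝ≥0∞, Measurable φ →
      ∫⁻ U, φ U ∂(G₀.law a) = ∫⁻ U, φ U * g n (a, U) ∂(G₁.law a))
    (n : ℕ) {φ : alg.Seed × Hist K n → ℝ≥0∞} (hφ : Measurable φ) :
    ∫⁻ ω, φ (alg.seedHist ω n) ∂(alg.runLaw G₀) =
      ∫⁻ ω, φ (alg.seedHist ω n) * histProd g n (alg.seedHist ω n).2 ∂(alg.runLaw G₁) := by
  induction n with
  | zero =>
    simp only [histProd, Finset.univ_eq_empty, Finset.prod_empty, mul_one, seedHist, runLaw]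
    have h : ∀ G : BanditGame K, ∫⁻ ω, φ (ω.1, Fin.elim0) ∂(alg.seedLaw.prod G.tableLaw) =
        ∫⁻ s, φ (s, Fin.elim0) ∂alg.seedLaw := fun G => by
      have : Measurable fun ω : alg.Seed × FeedbackTable K => φ (ω.1, Fin.elim0) :=
        hφ.comp (measurable_fst.prodMk measurable_const)
      rw [lintegral_prod _ this.aemeasurable]
      simp
    exact (h G₀).trans (h G₁).symm
  | succ n ih =>
    have hP := measurable_histProd hgm
    have hψ : Measurable fun q : (alg.Seed × Hist K n) × Payoffs N =>
        φ (q.1.1, Fin.snoc (α := fun _ => Profile K × Payoffs N) q.1.2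
          (alg.sample n q.1, q.2)) :=
      hφ.comp ((measurable_extend n).comp (measurable_fst.prodMk
        (((alg.measurable_sample n).comp measurable_fst).prodMk measurable_snd)))
    -- The last round is integrated out in both games, and the induction hypothesis is applied to
    -- the `G₀`-conditional expectation of `φ` as a function of the first `n` rounds.
    rw [lintegral_seedHist_succ _ _ _ hφ, lintegral_seedHist_succ _ _ _
      (φ := fun h => φ h * histProd g (n + 1) h.2) (hφ.mul ((hP _).comp measurable_snd)),
      ih (φ := fun h => ∫⁻ U, φ (h.1, Fin.snoc (α := fun _ => Profile K × Payoffs N) h.2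
        (alg.sample n h, U)) ∂(G₀.law (alg.sample n h)))
        (measurable_lintegral_law G₀ (alg.measurable_sample n) hψ)]
    refine lintegral_congr fun ω => ?_
    have h4 : Measurable fun U => φ ((alg.seedHist ω n).1,
      Fin.snoc (α := fun _ => Profile K × Payoffs N) (alg.seedHist ω n).2
        (alg.sample n (alg.seedHist ω n), U)) := hψ.comp measurable_prodMk_left
    simp only [histProd_snoc]
    have h5 : Measurable fun U => g n (alg.sample n (alg.seedHist ω n), U) :=
      (hgm n).comp measurable_prodMk_left
    have h6 : Measurable fun U => φ ((alg.seedHist ω n).1,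
      Fin.snoc (α := fun _ => Profile K × Payoffs N) (alg.seedHist ω n).2
        (alg.sample n (alg.seedHist ω n), U)) * g n (alg.sample n (alg.seedHist ω n), U) := h4.mul h5
    rw [hg n _ _ h4, ← lintegral_mul_const _ h6]
    refine lintegral_congr fun U => ?_
    ring

/-! ### Stopping times and optional stopping -/

/-- The seeds and histories of `n` rounds along which the algorithm has not stopped before. -/
def running (alg : Algorithm K) : ∀ n, Set (alg.Seed × Hist K n)
  | 0 => Set.univ
  | n + 1 => {x | (x.1, Fin.init x.2) ∈ running alg n \ alg.halt n}

lemma measurableSet_running (n : ℕ) : MeasurableSet (alg.running n) := by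
  induction n with
  | zero => exact .univ
  | succ n ih => exact measurable_init n (ih.diff (alg.measurableSet_halt n))

lemma seedHist_mem_running (ω : alg.Seed × FeedbackTable K) (n : ℕ) :
    alg.seedHist ω n ∈ alg.running n ↔ ∀ m < n, alg.seedHist ω m ∉ alg.halt m := by
  induction n with
  | zero => simp [running]
  | succ n ih =>
    rw [running, Set.mem_ofPred_eq, init_seedHist_succ, Set.mem_sdiff, ih, Nat.forall_lt_succ_right]

lemma stopsAt_iff (ω : alg.Seed × FeedbackTable K) (n : ℕ) :
    alg.StopsAt ω n ↔ alg.seedHist ω n ∈ alg.running n ∩ alg.halt n := by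
  rw [Set.mem_inter_iff, seedHist_mem_running, and_comm]; rfl

lemma measurableSet_stopsAt (n : ℕ) : MeasurableSet {ω | alg.StopsAt ω n} := by
  simp only [stopsAt_iff]
  exact alg.measurable_seedHist n ((alg.measurableSet_running n).inter (alg.measurableSet_halt n))

lemma StopsAt.unique {alg : Algorithm K} {ω : alg.Seed × FeedbackTable K} {m n : ℕ}
    (hm : alg.StopsAt ω m) (hn : alg.StopsAt ω n) : m = n := by
  rcases lt_trichotomy m n with h | h | h
  · exact absurd hm.1 (hn.2 m h)
  · exact h
  · exact absurd hn.1 (hm.2 n h)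

lemma numSamples_eq {alg : Algorithm K} {ω : alg.Seed × FeedbackTable K} {n : ℕ}
    (hn : alg.StopsAt ω n) : alg.numSamples ω = n := by
  refine le_antisymm (iInf₂_le n hn) (le_iInf₂ fun m hm => ?_)
  rw [hm.unique hn]

/-- Optional stopping for products of weights whose conditional expectation is at most `1`. -/
lemma tsum_lintegral_histProd_le (G : BanditGame K)
    {g : ℕ → Profile K × Payoffs N → ℝ≥0∞} (hgm : ∀ n, Measurable (g n))
    (hg : ∀ n a, ∫⁻ U, g n (a, U) ∂(G.law a) ≤ 1) :
    ∑' n, ∫⁻ ω, (alg.running n ∩ alg.halt n).indicator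
      (fun h => histProd g n h.2) (alg.seedHist ω n) ∂(alg.runLaw G) ≤ 1 := by
  have hP : ∀ n, Measurable fun h : alg.Seed × Hist K n => histProd g n h.2 :=
    fun n => (measurable_histProd hgm n).comp measurable_snd
  have hsH := alg.measurable_seedHist
  -- Weight already stopped plus weight still running is nonincreasing in `n` and starts at `1`.
  -- Dropping the running part needs no assumption that the algorithm stops.
  have key : ∀ n, ∑ t ∈ Finset.range n, ∫⁻ ω, (alg.running t ∩ alg.halt t).indicator
      (fun h => histProd g t h.2) (alg.seedHist ω t) ∂(alg.runLaw G) +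
      ∫⁻ ω, (alg.running n).indicator
        (fun h => histProd g n h.2) (alg.seedHist ω n) ∂(alg.runLaw G) ≤ 1 := by
    intro n
    induction n with
    | zero => simp [running, histProd]
    | succ n ih =>
      refine le_trans ?_ ih
      rw [Finset.sum_range_succ, add_assoc]
      gcongr
      have hI : Measurable fun ω => (alg.running n ∩ alg.halt n).indicator
          (fun h => histProd g n h.2) (alg.seedHist ω n) :=
        ((hP _).indicator ((alg.measurableSet_running n).inter (alg.measurableSet_halt n))).comp
          (hsH n)
      rw [lintegral_seedHist_succ _ _ _ ((hP _).indicator (alg.measurableSet_running _)),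
        ← lintegral_add_left hI]
      refine lintegral_mono fun ω => ?_
      set x := alg.seedHist ω n
      have h1 : ∀ U, (alg.running (n + 1)).indicator (fun h => histProd g (n + 1) h.2)
          (x.1, Fin.snoc (α := fun _ => Profile K × Payoffs N) x.2 (alg.sample n x, U)) =
          (alg.running n \ alg.halt n).indicator (fun h => histProd g n h.2) x *
            g n (alg.sample n x, U) := fun U => by
        have : ((x.1, Fin.snoc (α := fun _ => Profile K × Payoffs N) x.2 (alg.sample n x, U)) :
          alg.Seed × Hist K (n + 1)) ∈ alg.running (n + 1) ↔ x ∈ alg.running n \ alg.halt n := by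
          simp [running]
        by_cases hx : x ∈ alg.running n \ alg.halt n
        · rw [Set.indicator_of_mem (this.2 hx), Set.indicator_of_mem hx, histProd_snoc]
        · rw [Set.indicator_of_notMem (fun h => hx (this.1 h)), Set.indicator_of_notMem hx, zero_mul]
      simp only [h1]
      have h5 : Measurable fun U => g n (alg.sample n x, U) := (hgm n).comp measurable_prodMk_left
      rw [lintegral_const_mul _ h5]
      calc _ ≤ (alg.running n ∩ alg.halt n).indicator (fun h => histProd g n h.2) x +
            (alg.running n \ alg.halt n).indicator (fun h => histProd g n h.2) x * 1 := by
              gcongr; exact hg n _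
        _ = (alg.running n).indicator (fun h => histProd g n h.2) x := by
          rw [mul_one]
          by_cases hr : x ∈ alg.running n <;> by_cases hh : x ∈ alg.halt n <;> simp [hr, hh]
        _ ≤ _ := le_rfl
  rw [ENNReal.tsum_eq_iSup_nat]
  exact iSup_le fun n => le_self_add.trans (key n)

end Algorithm

/-! ### Iterated elimination -/

namespace Game

variable {N : ℕ} {K : Fin N → ℕ} (G : Game K) (Δ : ℝ)

lemma mem_elim_succ (l : ℕ) (p : Σ i, Fin (K i)) : p ∈ G.elim Δ (l + 1) ↔
    ∃ x ∈ stdSimplex ℝ (Fin (K p.1)), ∀ a : Profile K,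
      (∀ j, j ≠ p.1 → (⟨j, a j⟩ : Σ i, Fin (K i)) ∉ G.elim Δ l) →
        G.u p.1 (Function.update a p.1 p.2) ≤ G.mixedU p.1 x a - Δ := Iff.rfl

lemma elim_succ_subset (l : ℕ) : G.elim Δ l ⊆ G.elim Δ (l + 1) := by
  induction l with
  | zero => exact Set.empty_subset _
  | succ l ih =>
    intro p hp
    obtain ⟨x, hx, h⟩ := (mem_elim_succ G Δ l p).1 hp
    exact (mem_elim_succ G Δ (l + 1) p).2 ⟨x, hx, fun a ha => h a fun j hj hm => ha j hj (ih hm)⟩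

lemma elim_succ_eq_of_eq {l m : ℕ} (h : G.elim Δ l = G.elim Δ m) :
    G.elim Δ (l + 1) = G.elim Δ (m + 1) := by
  ext p
  rw [mem_elim_succ, mem_elim_succ, h]

lemma elim_eq_of_le {l m : ℕ} (h : G.elim Δ (l + 1) = G.elim Δ l) (hm : l ≤ m) :
    G.elim Δ m = G.elim Δ l := by
  induction m, hm using Nat.le_induction with
  | base => rfl
  | succ m _ ih => rw [elim_succ_eq_of_eq G Δ ih, h]

/-- An increasing chain of subsets of a finite set stabilizes, so the infimum defining the length is
over a nonempty set and is attained. -/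
lemma elimLength_spec : G.elim Δ (G.elimLength Δ + 1) = G.elim Δ (G.elimLength Δ) := by
  obtain ⟨n, hn⟩ := WellFoundedGT.monotone_chain_condition
    (⟨G.elim Δ, monotone_nat_of_le_succ (G.elim_succ_subset Δ)⟩ : ℕ →o Set (Σ i, Fin (K i)))
  have hne : {l | 1 ≤ l ∧ G.elim Δ (l + 1) = G.elim Δ l}.Nonempty :=
    ⟨n + 1, by omega, (hn (n + 2) (by omega)).symm.trans (hn (n + 1) (by omega))⟩
  exact (Nat.sInf_mem hne).2

lemma elim_of_elimLength_le {m : ℕ} (hm : G.elimLength Δ ≤ m) :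
    G.elim Δ m = G.elim Δ (G.elimLength Δ) :=
  G.elim_eq_of_le Δ (G.elimLength_spec Δ) hm

/-- Against one fixed profile a mixed strategy earns an average of pure payoffs, so some pure action
does at least as well. Mixed dominators thereby disappear from the argument. -/
lemma exists_sub_lt_of_mixedU {Δ : ℝ} {i : Fin N} {x : Fin (K i) → ℝ}
    (hx : x ∈ stdSimplex ℝ (Fin (K i))) {a : Profile K} {v : ℝ}
    (h : v ≤ G.mixedU i x a - Δ) : ∃ c, v ≤ G.u i (Function.update a i c) - Δ := by
  by_contra! hc
  have hne : ∃ b, x b ≠ 0 := by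
    by_contra! h0
    have := hx.2
    simp [h0] at this
  have h2 : G.mixedU i x a < ∑ b, x b * (v + Δ) := by
    refine Finset.sum_lt_sum (fun b _ => ?_) ?_
    · exact mul_le_mul_of_nonneg_left (by linarith [hc b]) (hx.1 b)
    · obtain ⟨b, hb⟩ := hne
      refine ⟨b, Finset.mem_univ b, mul_lt_mul_of_pos_left (by linarith [hc b]) ?_⟩
      exact lt_of_le_of_ne (hx.1 b) (Ne.symm hb)
  rw [← Finset.sum_mul, hx.2] at h2
  linarith

/-- If every player almost best responds to a profile of surviving actions, then the responses
survive one more round of elimination. -/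
lemma notMem_elim_succ {Δ : ℝ} {l : ℕ} {a : Profile K}
    (ha : ∀ j, (⟨j, a j⟩ : Σ i, Fin (K i)) ∉ G.elim Δ l) {i : Fin N} {b : Fin (K i)}
    (hb : ∀ c, G.u i (Function.update a i c) - Δ < G.u i (Function.update a i b)) :
    (⟨i, b⟩ : Σ i, Fin (K i)) ∉ G.elim Δ (l + 1) := by
  intro h
  obtain ⟨x, hx, h⟩ := (mem_elim_succ G Δ l _).1 h
  obtain ⟨c, hc⟩ := G.exists_sub_lt_of_mixedU hx (h a fun j _ => ha j)
  linarith [hb c]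

/-- If all actions outside a pure equilibrium are eliminated in two rounds, then the equilibrium
is the only rationalizable profile. -/
lemma rationalizable_iff_of_equilibrium {Δ : ℝ} (hΔ : 0 < Δ) {a : Profile K}
    (hne : ∀ i c, G.u i (Function.update a i c) ≤ G.u i a)
    (h2 : ∀ i c, c ≠ a i → (⟨i, c⟩ : Σ i, Fin (K i)) ∈ G.elim Δ 2) :
    G.elimLength Δ ≤ 2 ∧ ∀ b, G.RationalizableProfile Δ b ↔ b = a := by
  -- An equilibrium is its own exact best response, hence survives every round because `Δ > 0`.
  have hsurv : ∀ l j, (⟨j, a j⟩ : Σ i, Fin (K i)) ∉ G.elim Δ l := by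
    intro l
    induction l with
    | zero => intro j h; exact h
    | succ l ih =>
      intro j
      refine G.notMem_elim_succ ih fun c => ?_
      rw [Function.update_eq_self]
      linarith [hne j c]
  have h32 : G.elim Δ (2 + 1) = G.elim Δ 2 := by
    refine (Set.Subset.antisymm ?_ (G.elim_succ_subset Δ 2))
    rintro ⟨i, c⟩ hc
    refine h2 i c ?_
    rintro rfl
    exact hsurv _ _ hc
  have hL : G.elimLength Δ ≤ 2 := Nat.sInf_le ⟨by norm_num, h32⟩
  refine ⟨hL, fun b => ?_⟩
  rw [RationalizableProfile, ← G.elim_of_elimLength_le Δ hL]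
  constructor
  · intro h
    funext i
    by_contra hi
    exact h i (h2 i _ hi)
  · rintro rfl
    exact hsurv 2

end Game

/-! ### Comparing two games by a truncated second moment -/

/-- This is `(y - 4) ^ 2 ≥ 0`. With `y` a likelihood ratio, it splits a probability in one game into
twice the probability in the other plus a small multiple of the second moment. -/
lemma ENNReal.le_two_add_sq_div (y : ℝ≥0∞) : y ≤ 2 + y ^ 2 / 8 := by
  induction y with
  | top => simp [ENNReal.top_div]
  | coe y =>
    have : y ≤ 2 + y ^ 2 / 8 := by
      rw [← NNReal.coe_le_coe]
      push_cast
      nlinarith [sq_nonneg ((y : ℝ) - 4)]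
    calc (y : ℝ≥0∞) ≤ ((2 + y ^ 2 / 8 : NNReal) : ℝ≥0∞) := by exact_mod_cast this
      _ = _ := by rw [ENNReal.coe_add, ENNReal.coe_div (by norm_num)]; norm_cast

namespace Algorithm

variable {N : ℕ} {K : Fin N → ℕ} (alg : Algorithm K)

/-- The number of rounds of a history in which a profile was played. -/
def playCount (a : Profile K) {n : ℕ} (h : Hist K n) : ℕ :=
  (Finset.univ.filter fun t => (h t).1 = a).card

lemma measurable_playCount (a : Profile K) (n : ℕ) :
    Measurable fun h : Hist K n => playCount a h := by
  simp only [playCount, Finset.card_filter]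
  refine Finset.measurable_sum _ fun t _ => ?_
  exact (measurable_of_countable fun b : Profile K => if b = a then 1 else 0).comp
    (measurable_fst.comp (measurable_pi_apply t))

/-- The event that the algorithm stops and outputs a profile in `R`. -/
def outputs (R : Set (Profile K)) : Set (alg.Seed × FeedbackTable K) :=
  {ω | ∃ n, alg.StopsAt ω n ∧ alg.recommend n (alg.seedHist ω n) ∈ R}

lemma measurableSet_stopsAt_recommend (R : Set (Profile K)) (n : ℕ) :
    MeasurableSet {ω | alg.StopsAt ω n ∧ alg.recommend n (alg.seedHist ω n) ∈ R} :=
  (alg.measurableSet_stopsAt n).inter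
    (((alg.measurable_recommend n).comp (alg.measurable_seedHist n)) (MeasurableSet.of_discrete))

lemma outputs_eq_iUnion (R : Set (Profile K)) : alg.outputs R =
    ⋃ n, {ω | alg.StopsAt ω n ∧ alg.recommend n (alg.seedHist ω n) ∈ R} := by
  ext ω; simp [outputs]

lemma measurableSet_outputs (R : Set (Profile K)) : MeasurableSet (alg.outputs R) := by
  rw [outputs_eq_iUnion]
  exact .iUnion fun n => alg.measurableSet_stopsAt_recommend R n

/-- If two games differ only in the feedback law of `a`, then an output that is unlikely in one of
them is unlikely in the other as long as `a` is played only a few times. -/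
lemma measure_outputs_playCount_le (G₀ G₁ : BanditGame K) (a : Profile K) {f : Payoffs N → ℝ≥0∞}
    (hf : Measurable f) {r : ℝ≥0∞} (hr1 : 1 ≤ r) (hrt : r ≠ ∞)
    (h0 : ∀ b, b ≠ a → G₀.law b = G₁.law b)
    (h1 : ∀ φ : Payoffs N → ℝ≥0∞, Measurable φ →
      ∫⁻ U, φ U ∂(G₀.law a) = ∫⁻ U, φ U * f U ∂(G₁.law a))
    (h2 : ∫⁻ U, f U ^ 2 ∂(G₁.law a) ≤ r) (R : Set (Profile K)) (k : ℕ) :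
    alg.runLaw G₀ {ω | ∃ n, alg.StopsAt ω n ∧ alg.recommend n (alg.seedHist ω n) ∈ R ∧
      playCount a (alg.seedHist ω n).2 ≤ k} ≤ 2 * alg.runLaw G₁ (alg.outputs R) + r ^ k / 8 := by
  have hr0 : r ≠ 0 := (zero_lt_one.trans_le hr1).ne'
  set g : ℕ → Profile K × Payoffs N → ℝ≥0∞ := fun _ x => if x.1 = a then f x.2 else 1 with hgdef
  -- Dividing the squared ratio by `r` at each play of `a` brings its conditional mean under `G₁`
  -- down to at most `1`; the compensating factor `r ^ playCount` is at most `r ^ k` on the event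
  -- considered.
  set g2 : ℕ → Profile K × Payoffs N → ℝ≥0∞ :=
    fun _ x => if x.1 = a then f x.2 ^ 2 * r⁻¹ else 1 with hg2def
  have hset : MeasurableSet {x : Profile K × Payoffs N | x.1 = a} :=
    measurable_fst (MeasurableSet.singleton a)
  have hgm : ∀ n, Measurable (g n) := fun n =>
    Measurable.ite hset (hf.comp measurable_snd) measurable_const
  have hg2m : ∀ n, Measurable (g2 n) := fun n =>
    Measurable.ite hset (((hf.comp measurable_snd).pow_const 2).mul_const _) measurable_const
  have hg : ∀ n b, ∀ φ : Payoffs N → ℝ≥0∞, Measurable φ →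
      ∫⁻ U, φ U ∂(G₀.law b) = ∫⁻ U, φ U * g n (b, U) ∂(G₁.law b) := by
    intro n b φ hφ
    by_cases hb : b = a
    · subst hb; simpa [hgdef] using h1 φ hφ
    · simp [hgdef, hb, h0 b hb]
  have hg2 : ∀ n b, ∫⁻ U, g2 n (b, U) ∂(G₁.law b) ≤ 1 := by
    intro n b
    by_cases hb : b = a
    · subst hb
      simp only [hg2def, if_true]
      rw [lintegral_mul_const _ (hf.pow_const 2)]
      calc _ ≤ r * r⁻¹ := by gcongr
        _ = 1 := ENNReal.mul_inv_cancel hr0 hrt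
    · simp [hg2def, hb]
  have hsq : ∀ n (h : Hist K n), histProd g n h ^ 2 = histProd g2 n h * r ^ playCount a h := by
    intro n h
    simp only [histProd, playCount, ← Finset.prod_pow]
    rw [← Finset.prod_const, Finset.prod_filter, ← Finset.prod_mul_distrib]
    refine Finset.prod_congr rfl fun t _ => ?_
    by_cases ht : (h t).1 = a
    · simp [hgdef, hg2def, ht, mul_assoc, ENNReal.inv_mul_cancel hr0 hrt]
    · simp [hgdef, hg2def, ht]
  set D : ∀ n, Set (alg.Seed × Hist K n) := fun n =>
    (alg.running n ∩ alg.halt n) ∩ {x | alg.recommend n x ∈ R ∧ playCount a x.2 ≤ k} with hD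
  set S : ∀ n, Set (alg.Seed × Hist K n) := fun n =>
    (alg.running n ∩ alg.halt n) ∩ {x | alg.recommend n x ∈ R} with hS
  have hStop : ∀ n, MeasurableSet (alg.running n ∩ alg.halt n) := fun n =>
    (alg.measurableSet_running n).inter (alg.measurableSet_halt n)
  have hRm : ∀ n, MeasurableSet {x | alg.recommend n x ∈ R} := fun n =>
    alg.measurable_recommend n MeasurableSet.of_discrete
  have hDm : ∀ n, MeasurableSet (D n) := fun n => (hStop n).inter ((hRm n).inter
    (((measurable_playCount a n).comp measurable_snd) (measurableSet_Iic (a := k))))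
  have hSm : ∀ n, MeasurableSet (S n) := fun n => (hStop n).inter (hRm n)
  have hpt : ∀ n (x : alg.Seed × Hist K n), (D n).indicator 1 x * histProd g n x.2 ≤
      2 * (S n).indicator 1 x + r ^ k / 8 *
        (alg.running n ∩ alg.halt n).indicator (fun h => histProd g2 n h.2) x := by
    intro n x
    by_cases hx : x ∈ D n
    · have hxS : x ∈ S n := ⟨hx.1, hx.2.1⟩
      rw [Set.indicator_of_mem hx, Set.indicator_of_mem hxS, Set.indicator_of_mem hx.1]
      simp only [Pi.one_apply, one_mul, mul_one]
      refine (ENNReal.le_two_add_sq_div _).trans ?_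
      rw [hsq]
      gcongr
      calc histProd g2 n x.2 * r ^ playCount a x.2 / 8 ≤ histProd g2 n x.2 * r ^ k / 8 := by
            gcongr
            exact hx.2.2
        _ = _ := by simp only [div_eq_mul_inv]; ring
    · simp [Set.indicator_of_notMem hx]
  have hSrun : ∀ n, {ω | alg.StopsAt ω n ∧ alg.recommend n (alg.seedHist ω n) ∈ R} =
      (fun ω => alg.seedHist ω n) ⁻¹' S n := fun n => by
    ext ω
    simp only [Set.mem_ofPred_eq, Set.mem_preimage, hS, Set.mem_inter_iff, stopsAt_iff]
  have hm2 : ∀ n, Measurable fun ω => (alg.running n ∩ alg.halt n).indicator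
      (fun h => histProd g2 n h.2) (alg.seedHist ω n) := fun n =>
    (((measurable_histProd hg2m n).comp measurable_snd).indicator (hStop n)).comp
      (alg.measurable_seedHist n)
  have hmS : ∀ n, Measurable fun ω => (S n).indicator (1 : alg.Seed × Hist K n → ℝ≥0∞) (alg.seedHist ω n) := fun n =>
    (measurable_one.indicator (hSm n)).comp (alg.measurable_seedHist n)
  calc _ ≤ alg.runLaw G₀ (⋃ n, (fun ω => alg.seedHist ω n) ⁻¹' D n) := by
        refine measure_mono ?_
        rintro ω ⟨n, hn, hR, hk⟩
        exact Set.mem_iUnion.2 ⟨n, (alg.stopsAt_iff ω n).1 hn, hR, hk⟩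
    _ ≤ ∑' n, alg.runLaw G₀ ((fun ω => alg.seedHist ω n) ⁻¹' D n) := measure_iUnion_le _
    _ = ∑' n, ∫⁻ ω, (D n).indicator 1 (alg.seedHist ω n) ∂(alg.runLaw G₀) := by
        refine tsum_congr fun n => ?_
        rw [← lintegral_indicator_one (alg.measurable_seedHist n (hDm n))]
        rfl
    _ = ∑' n, ∫⁻ ω, (D n).indicator 1 (alg.seedHist ω n) * histProd g n (alg.seedHist ω n).2
          ∂(alg.runLaw G₁) := by
        refine tsum_congr fun n => ?_
        exact alg.lintegral_change_of_measure G₀ G₁ hgm hg n (measurable_one.indicator (hDm n))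
    _ ≤ ∑' n, (2 * ∫⁻ ω, (S n).indicator 1 (alg.seedHist ω n) ∂(alg.runLaw G₁) + r ^ k / 8 *
          ∫⁻ ω, (alg.running n ∩ alg.halt n).indicator
            (fun h => histProd g2 n h.2) (alg.seedHist ω n) ∂(alg.runLaw G₁)) := by
        refine ENNReal.tsum_le_tsum fun n => ?_
        rw [← lintegral_const_mul _ (hmS n), ← lintegral_const_mul _ (hm2 n),
          ← lintegral_add_left ((hmS n).const_mul 2)]
        exact lintegral_mono fun ω => hpt n _
    _ = 2 * ∑' n, ∫⁻ ω, (S n).indicator 1 (alg.seedHist ω n) ∂(alg.runLaw G₁) + r ^ k / 8 *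
          ∑' n, ∫⁻ ω, (alg.running n ∩ alg.halt n).indicator
            (fun h => histProd g2 n h.2) (alg.seedHist ω n) ∂(alg.runLaw G₁) := by
        rw [ENNReal.tsum_add, ENNReal.tsum_mul_left, ENNReal.tsum_mul_left]
    _ ≤ 2 * alg.runLaw G₁ (alg.outputs R) + r ^ k / 8 * 1 := by
        gcongr
        · rw [outputs_eq_iUnion, measure_iUnion]
          · refine (ENNReal.tsum_le_tsum fun n => ?_)
            rw [hSrun, ← lintegral_indicator_one (alg.measurable_seedHist n (hSm n))]
            exact le_rfl
          · intro m n hmn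
            refine Set.disjoint_left.2 fun ω hm hn => hmn (hm.1.unique hn.1)
          · exact fun n => alg.measurableSet_stopsAt_recommend R n
        · exact alg.tsum_lintegral_histProd_le G₁ hg2m hg2
    _ = _ := by rw [mul_one]

/-- Each round plays one profile, which by injectivity is counted for at most one index. -/
lemma sum_playCount_le {ι : Type*} [Fintype ι] {a : ι → Profile K} (ha : Function.Injective a)
    {n : ℕ} (h : Hist K n) : ∑ p, playCount (a p) h ≤ n := by
  classical
  simp only [playCount, Finset.card_filter]
  rw [Finset.sum_comm]
  calc _ ≤ ∑ t : Fin n, 1 := by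
        refine Finset.sum_le_sum fun t _ => ?_
        rw [← Finset.card_filter, Finset.card_le_one]
        intro p hp q hq
        exact ha ((Finset.mem_filter.1 hp).2.symm.trans (Finset.mem_filter.1 hq).2)
    _ = n := by simp

/-- If each of several profiles is played at least `k` times with probability at least `q`, then
the numbers of samples add up. -/
lemma le_expectedSamples (G : BanditGame K) {ι : Type*} [Fintype ι] [Nonempty ι]
    {a : ι → Profile K} (ha : Function.Injective a) (k : ℕ) (q : ℝ≥0∞)
    (h : ∀ p, q ≤ alg.runLaw G {ω | ∃ n, alg.StopsAt ω n ∧ k ≤ playCount (a p) (alg.seedHist ω n).2}) :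
    Fintype.card ι * (k * q) ≤ alg.expectedSamples G := by
  set Q : ι → Set (alg.Seed × FeedbackTable K) :=
    fun p => {ω | ∃ n, alg.StopsAt ω n ∧ k ≤ playCount (a p) (alg.seedHist ω n).2} with hQ
  have hQm : ∀ p, MeasurableSet (Q p) := fun p => by
    have : Q p = ⋃ n, ({ω | alg.StopsAt ω n} ∩
        (fun ω => playCount (a p) (alg.seedHist ω n).2) ⁻¹' Set.Ici k) := by
      ext ω; simp [hQ]
    rw [this]
    exact .iUnion fun n => (alg.measurableSet_stopsAt n).inter
      (((measurable_playCount (a p) n).comp (measurable_snd.comp (alg.measurable_seedHist n)))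
        measurableSet_Ici)
  calc (Fintype.card ι * (k * q) : ℝ≥0∞) = ∑ _p : ι, (k : ℝ≥0∞) * q := by simp
    _ ≤ ∑ p, (k : ℝ≥0∞) * alg.runLaw G (Q p) := by
        gcongr with p; exact h p
    _ = ∫⁻ ω, ∑ p, (k : ℝ≥0∞) * (Q p).indicator 1 ω ∂(alg.runLaw G) := by
        rw [lintegral_finsetSum _ fun p _ => (measurable_one.indicator (hQm p)).const_mul _]
        refine Finset.sum_congr rfl fun p _ => ?_
        rw [lintegral_const_mul _ (measurable_one.indicator (hQm p)),
          lintegral_indicator_one (hQm p)]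
    _ ≤ alg.expectedSamples G := by
        -- Runs that never stop need no argument: the infimum defining their sample count is over
        -- the empty set and equals `∞`.
        refine lintegral_mono fun ω => le_iInf₂ fun n hn => ?_
        calc ∑ p, (k : ℝ≥0∞) * (Q p).indicator 1 ω
            ≤ ∑ p, (playCount (a p) (alg.seedHist ω n).2 : ℝ≥0∞) := by
              refine Finset.sum_le_sum fun p _ => ?_
              by_cases hp : ω ∈ Q p
              · obtain ⟨m, hm, hk⟩ := hp
                obtain rfl := hm.unique hn
                rw [Set.indicator_of_mem (show ω ∈ Q p from ⟨m, hm, hk⟩)]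
                simpa using hk
              · simp [Set.indicator_of_notMem hp]
          _ ≤ n := by exact_mod_cast sum_playCount_le ha _

end Algorithm

/-! ### The hard games -/

/-- The law of a payoff vector in which player `d` receives a coin flip of mean `w d` and every
other player `j` the constant `w j`. -/
noncomputable def coinLaw {N : ℕ} (d : Fin N) (w : Payoffs N) : Measure (Payoffs N) :=
  ENNReal.ofReal (1 - w d) • Measure.dirac (Function.update w d 0) +
    ENNReal.ofReal (w d) • Measure.dirac (Function.update w d 1)

lemma lintegral_coinLaw {N : ℕ} (d : Fin N) (w : Payoffs N) {φ : Payoffs N → ℝ≥0∞}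
    (hφ : Measurable φ) : ∫⁻ U, φ U ∂(coinLaw d w) =
      ENNReal.ofReal (1 - w d) * φ (Function.update w d 0) +
        ENNReal.ofReal (w d) * φ (Function.update w d 1) := by
  rw [coinLaw, lintegral_add_measure, lintegral_smul_measure, lintegral_smul_measure,
    lintegral_dirac' _ hφ, lintegral_dirac' _ hφ]
  rfl

instance {N : ℕ} (d : Fin N) (w : Payoffs N) : IsProbabilityMeasure (coinLaw d w) := by
  constructor
  have h := lintegral_coinLaw d w (measurable_one (α := ℝ≥0∞))
  simp only [Pi.one_apply, lintegral_one, mul_one] at h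
  rw [h, ← ENNReal.ofReal_add (by linarith [(w d).2.2]) (w d).2.1]
  simp

lemma integral_coinLaw {N : ℕ} (d : Fin N) (w : Payoffs N) (i : Fin N) :
    ∫ U, ((U i : Set.Icc (0 : ℝ) 1) : ℝ) ∂(coinLaw d w) = w i := by
  have hm : Measurable fun U : Payoffs N => ((U i : Set.Icc (0 : ℝ) 1) : ℝ) :=
    measurable_subtype_coe.comp (measurable_pi_apply i)
  have h1 : (0 : ℝ) ≤ 1 - w d := by linarith [(w d).2.2]
  have h2 : ∀ t : ℝ, 0 ≤ t → ∀ z : Set.Icc (0 : ℝ) 1, 0 ≤ t * (z : ℝ) :=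
    fun t ht z => mul_nonneg ht z.2.1
  rw [integral_eq_lintegral_of_nonneg_ae (ae_of_all _ fun U => (U i).2.1) hm.aestronglyMeasurable,
    lintegral_coinLaw d w hm.ennreal_ofReal, ← ENNReal.ofReal_mul h1, ← ENNReal.ofReal_mul (w d).2.1,
    ← ENNReal.ofReal_add (h2 _ h1 _) (h2 _ (w d).2.1 _),
    ENNReal.toReal_ofReal (add_nonneg (h2 _ h1 _) (h2 _ (w d).2.1 _))]
  by_cases h : i = d
  · subst h; simp
  · simp only [Function.update_of_ne h]
    ring

section HardGames

variable {N A : ℕ} [NeZero A]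

/-- Action `0` is better than every other action by `Δ`, except that the deviation `(i, b)` pays
more against the profile `0`, if `s = some (i, b)`. -/
noncomputable def hardU (Δ : ℝ) (s : Option (Fin N × Fin A)) (j : Fin N)
    (a : Profile fun _ : Fin N => A) : ℝ :=
  open Classical in
  if s = some (j, a j) ∧ ∀ k, k ≠ j → a k = 0 then 1 / 2
  else if a j = 0 then 1 / 2 - Δ else 1 / 2 - 2 * Δ

open Classical in
/-- A player that deviates from the profile `0`, if there is one. -/
noncomputable def deviator (i₀ : Fin N) (a : Profile fun _ : Fin N => A) : Fin N :=
  if h : ∃ i, a i ≠ 0 then h.choose else i₀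

lemma deviator_update (i₀ i : Fin N) {b : Fin A} (hb : b ≠ 0) :
    deviator i₀ (Function.update (0 : Profile fun _ : Fin N => A) i b) = i := by
  have h : ∃ j, Function.update (0 : Profile fun _ : Fin N => A) i b j ≠ 0 := ⟨i, by simpa using hb⟩
  rw [deviator, dif_pos h]
  by_contra hj
  exact h.choose_spec (by rw [Function.update_of_ne hj]; rfl)

lemma hardU_mem {Δ : ℝ} (h0 : 0 < Δ) (h1 : Δ < 1 / 10) (s : Option (Fin N × Fin A)) (j : Fin N)
    (a : Profile fun _ : Fin N => A) : hardU Δ s j a ∈ Set.Icc (0 : ℝ) 1 := by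
  unfold hardU
  constructor <;> split_ifs <;> linarith

/-- The payoff vector of a profile. -/
noncomputable def hardPayoffs {Δ : ℝ} (h0 : 0 < Δ) (h1 : Δ < 1 / 10) (s : Option (Fin N × Fin A))
    (a : Profile fun _ : Fin N => A) : Payoffs N :=
  fun j => ⟨hardU Δ s j a, hardU_mem h0 h1 s j a⟩

lemma coe_hardPayoffs {Δ : ℝ} (h0 : 0 < Δ) (h1 : Δ < 1 / 10) (s : Option (Fin N × Fin A))
    (a : Profile fun _ : Fin N => A) (j : Fin N) :
    (hardPayoffs h0 h1 s a j : ℝ) = hardU Δ s j a := rfl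

/-- The hard instances of the lower bound. Only the payoff of the deviating player is random. -/
noncomputable def hardGame (i₀ : Fin N) {Δ : ℝ} (h0 : 0 < Δ) (h1 : Δ < 1 / 10)
    (s : Option (Fin N × Fin A)) : BanditGame (fun _ : Fin N => A) where
  u := hardU Δ s
  u_mem := hardU_mem h0 h1 s
  -- Whose payoff is random depends on `a` but not on `s`, so two instances have equal laws wherever
  -- their mean payoffs agree.
  law a := coinLaw (deviator i₀ a) (hardPayoffs h0 h1 s a)
  isProbabilityMeasure_law _ := inferInstance
  mean_law _ i := integral_coinLaw _ _ i

lemma hardGame_u (i₀ : Fin N) {Δ : ℝ} (h0 : 0 < Δ) (h1 : Δ < 1 / 10)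
    (s : Option (Fin N × Fin A)) (j : Fin N) (a : Profile fun _ : Fin N => A) :
    (hardGame i₀ h0 h1 s).u j a = hardU Δ s j a := rfl

/-- The profile that the hard instance makes rationalizable. -/
def hardProfile (s : Option (Fin N × Fin A)) : Profile fun _ : Fin N => A :=
  s.elim 0 fun p => Function.update (0 : Profile fun _ : Fin N => A) p.1 p.2

lemma hardU_le_half {Δ : ℝ} (h0 : 0 < Δ) (s : Option (Fin N × Fin A)) (j : Fin N)
    (a : Profile fun _ : Fin N => A) : hardU Δ s j a ≤ 1 / 2 := by
  unfold hardU
  split_ifs <;> linarith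

lemma hardU_of_not {Δ : ℝ} {s : Option (Fin N × Fin A)} {j : Fin N}
    {a : Profile fun _ : Fin N => A} (h : ¬ (s = some (j, a j) ∧ ∀ k, k ≠ j → a k = 0)) :
    hardU Δ s j a = if a j = 0 then 1 / 2 - Δ else 1 / 2 - 2 * Δ := by
  rw [hardU, if_neg h]

lemma hardGame_dominated (i₀ : Fin N) {Δ : ℝ} (h0 : 0 < Δ) (h1 : Δ < 1 / 10)
    (s : Option (Fin N × Fin A)) {l : ℕ} {j : Fin N} {c b : Fin A}
    (h : ∀ a : Profile fun _ : Fin N => A,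
      (∀ k, k ≠ j → (⟨k, a k⟩ : Σ _ : Fin N, Fin A) ∉ (hardGame i₀ h0 h1 s).elim Δ l) →
      hardU Δ s j (Function.update a j c) ≤ hardU Δ s j (Function.update a j b) - Δ) :
    (⟨j, c⟩ : Σ _ : Fin N, Fin A) ∈ (hardGame i₀ h0 h1 s).elim Δ (l + 1) := by
  refine (Game.mem_elim_succ _ Δ l _).2 ⟨Pi.single b 1, single_mem_stdSimplex ℝ b, fun a ha => ?_⟩
  have : (hardGame i₀ h0 h1 s).mixedU j (Pi.single b 1) a =
      hardU Δ s j (Function.update a j b) := by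
    simp [Game.mixedU, Pi.single_apply, hardGame]
  rw [this]
  exact h a ha

/-- Round one removes all nonzero actions except the special `(i, b)`, each dominated by `0`. The
opponents of `i` then play `0`, where `b` earns `1/2` against `1/2 - Δ` for action `0`; this gap of
exactly `Δ` suffices for round two. -/
lemma hardGame_spec (i₀ : Fin N) {Δ : ℝ} (h0 : 0 < Δ) (h1 : Δ < 1 / 10)
    (s : Option (Fin N × Fin A)) (hs : ∀ p ∈ s, p.2 ≠ 0) :
    (hardGame i₀ h0 h1 s).elimLength Δ ≤ 2 ∧
      ∀ b, (hardGame i₀ h0 h1 s).RationalizableProfile Δ b ↔ b = hardProfile s := by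
  have hE1 : ∀ j c, c ≠ 0 → s ≠ some (j, c) →
      (⟨j, c⟩ : Σ _ : Fin N, Fin A) ∈ (hardGame i₀ h0 h1 s).elim Δ 1 := by
    intro j c hc hjc
    refine hardGame_dominated i₀ h0 h1 s (b := 0) fun a ha => ?_
    rw [hardU_of_not (by simp [hjc]), hardU_of_not, Function.update_self, Function.update_self,
      if_neg hc, if_pos rfl]
    · linarith
    · rintro ⟨h, -⟩
      exact hs _ h (by simp)
  refine (hardGame i₀ h0 h1 s).rationalizable_iff_of_equilibrium h0 ?_ ?_
  · intro j c
    cases s with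
    | none =>
      rw [hardGame_u, hardGame_u, hardU_of_not (by simp), hardU_of_not (by simp)]
      rw [Function.update_self, if_pos (show hardProfile none j = 0 from rfl)]
      split_ifs <;> linarith
    | some p =>
      obtain ⟨i, b⟩ := p
      rw [hardGame_u, hardGame_u]
      simp only [hardProfile, Option.elim]
      by_cases hj : j = i
      · subst hj
        have : hardU Δ (some (j, b)) j (Function.update (0 : Profile fun _ : Fin N => A) j b) = 1 / 2 := by
          rw [hardU, if_pos]
          refine ⟨by simp, fun k hk => by simp [Function.update_of_ne hk]⟩
        rw [this]
        exact hardU_le_half h0 _ _ _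
      · rw [hardU_of_not (fun h => hj (by simpa using (congrArg Prod.fst (Option.some.inj h.1)).symm)),
          hardU_of_not (fun h => hj (by simpa using (congrArg Prod.fst (Option.some.inj h.1)).symm))]
        rw [Function.update_of_ne hj]
        simp only [Pi.zero_apply, if_true]
        split_ifs <;> linarith
  · intro j c hc
    by_cases hc0 : c = 0
    · subst hc0
      cases s with
      | none => exact absurd rfl hc
      | some p =>
        obtain ⟨i, b⟩ := p
        have hb : b ≠ 0 := hs _ rfl
        simp only [hardProfile, Option.elim] at hc
        have hj : j = i := by
          by_contra hj
          exact hc (by rw [Function.update_of_ne hj]; rfl)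
        subst hj
        refine hardGame_dominated i₀ h0 h1 _ (b := b) fun a ha => ?_
        have hz : ∀ k, k ≠ j → a k = 0 := by
          intro k hk
          by_contra hak
          exact ha k hk (hE1 k _ hak fun h => hk (congrArg Prod.fst (Option.some.inj h)).symm)
        have hj0 : hardU Δ (some (j, b)) j (Function.update a j 0) = 1 / 2 - Δ := by
          rw [hardU_of_not (fun h => hb (by simpa using h.1)), Function.update_self, if_pos rfl]
        have hjb : hardU Δ (some (j, b)) j (Function.update a j b) = 1 / 2 := by
          rw [hardU, if_pos]
          exact ⟨by simp, fun k hk => by rw [Function.update_of_ne hk]; exact hz k hk⟩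
        rw [hj0, hjb]
    · refine (hardGame i₀ h0 h1 s).elim_succ_subset Δ 1 (hE1 j c hc0 ?_)
      rintro rfl
      exact hc (by simp [hardProfile])

/-- The likelihood ratio of a coin of mean `1 / 2 - 2 * Δ` and a fair coin. -/
noncomputable def coinRatio (Δ : ℝ) (i : Fin N) (U : Payoffs N) : ℝ≥0∞ :=
  open Classical in
  if U i = 1 then ENNReal.ofReal (1 - 4 * Δ) else ENNReal.ofReal (1 + 4 * Δ)

lemma measurable_coinRatio (Δ : ℝ) (i : Fin N) : Measurable (coinRatio Δ i) :=
  Measurable.ite ((measurable_pi_apply i) (MeasurableSet.singleton 1)) measurable_const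
    measurable_const

lemma hardPayoffs_some_self {Δ : ℝ} (h0 : 0 < Δ) (h1 : Δ < 1 / 10) (i : Fin N) (b : Fin A) :
    (hardPayoffs h0 h1 (some (i, b)) (Function.update (0 : Profile fun _ : Fin N => A) i b) i : ℝ) = 1 / 2 := by
  rw [coe_hardPayoffs, hardU, if_pos]
  exact ⟨by simp, fun k hk => by simp [Function.update_of_ne hk]⟩

lemma hardPayoffs_none_self {Δ : ℝ} (h0 : 0 < Δ) (h1 : Δ < 1 / 10) (i : Fin N) {b : Fin A}
    (hb : b ≠ 0) :
    (hardPayoffs h0 h1 none (Function.update (0 : Profile fun _ : Fin N => A) i b) i : ℝ) = 1 / 2 - 2 * Δ := by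
  rw [coe_hardPayoffs, hardU_of_not (by simp), Function.update_self, if_neg hb]

/-- The two payoff vectors differ only at `i`, the coordinate overwritten by the coin. Both laws
therefore have the same two atoms, and the likelihood ratio is that of two coins. -/
lemma update_hardPayoffs {Δ : ℝ} (h0 : 0 < Δ) (h1 : Δ < 1 / 10) (i : Fin N) (b : Fin A)
    (z : Set.Icc (0 : ℝ) 1) :
    Function.update (hardPayoffs h0 h1 none (Function.update (0 : Profile fun _ : Fin N => A) i b)) i z =
      Function.update (hardPayoffs h0 h1 (some (i, b)) (Function.update (0 : Profile fun _ : Fin N => A) i b)) i z := by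
  funext j
  by_cases hj : j = i
  · subst hj; simp
  · rw [Function.update_of_ne hj, Function.update_of_ne hj]
    refine Subtype.ext ?_
    rw [coe_hardPayoffs, coe_hardPayoffs, hardU_of_not (by simp), hardU_of_not]
    exact fun h => hj (congrArg Prod.fst (Option.some.inj h.1)).symm

lemma hardGame_law_of_ne (i₀ : Fin N) {Δ : ℝ} (h0 : 0 < Δ) (h1 : Δ < 1 / 10) (i : Fin N)
    (b : Fin A) (a : Profile fun _ : Fin N => A) (ha : a ≠ Function.update (0 : Profile fun _ : Fin N => A) i b) :
    (hardGame i₀ h0 h1 none).law a = (hardGame i₀ h0 h1 (some (i, b))).law a := by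
  have : hardPayoffs h0 h1 none a = hardPayoffs h0 h1 (some (i, b)) a := by
    funext j
    refine Subtype.ext ?_
    rw [coe_hardPayoffs, coe_hardPayoffs, hardU_of_not (by simp), hardU_of_not]
    rintro ⟨h, hz⟩
    obtain ⟨rfl, rfl⟩ := Prod.mk.inj (Option.some.inj h)
    refine ha (funext fun k => ?_)
    by_cases hk : k = i
    · subst hk; simp
    · rw [Function.update_of_ne hk, hz k hk]; rfl
  change coinLaw _ _ = coinLaw _ _
  rw [this]

lemma lintegral_hardGame_none (i₀ : Fin N) {Δ : ℝ} (h0 : 0 < Δ) (h1 : Δ < 1 / 10) (i : Fin N)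
    {b : Fin A} (hb : b ≠ 0) {φ : Payoffs N → ℝ≥0∞} (hφ : Measurable φ) :
    ∫⁻ U, φ U ∂((hardGame i₀ h0 h1 none).law (Function.update (0 : Profile fun _ : Fin N => A) i b)) =
      ∫⁻ U, φ U * coinRatio Δ i U
        ∂((hardGame i₀ h0 h1 (some (i, b))).law (Function.update (0 : Profile fun _ : Fin N => A) i b)) := by
  change ∫⁻ U, φ U ∂(coinLaw _ _) = ∫⁻ U, φ U * coinRatio Δ i U ∂(coinLaw _ _)
  rw [deviator_update _ _ hb, lintegral_coinLaw _ _ hφ,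
    lintegral_coinLaw _ _ (φ := fun U => φ U * coinRatio Δ i U)
    (hφ.mul (measurable_coinRatio Δ i)), hardPayoffs_some_self, hardPayoffs_none_self _ _ _ hb,
    update_hardPayoffs, update_hardPayoffs, mul_comm (φ _), mul_comm (φ _), ← mul_assoc,
    ← mul_assoc]
  simp only [coinRatio, Function.update_self, if_true, zero_ne_one, if_false]
  rw [← ENNReal.ofReal_mul (by norm_num), ← ENNReal.ofReal_mul (by norm_num)]
  congr 4 <;> ring

/-- Under the fair coin the second moment is the average of `(1 - 4Δ)²` and `(1 + 4Δ)²`. -/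
lemma lintegral_coinRatio_sq (i₀ : Fin N) {Δ : ℝ} (h0 : 0 < Δ) (h1 : Δ < 1 / 10) (i : Fin N)
    {b : Fin A} (hb : b ≠ 0) :
    ∫⁻ U, coinRatio Δ i U ^ 2 ∂((hardGame i₀ h0 h1 (some (i, b))).law (Function.update (0 : Profile fun _ : Fin N => A) i b)) =
      ENNReal.ofReal (1 + 16 * Δ ^ 2) := by
  change ∫⁻ U, coinRatio Δ i U ^ 2 ∂(coinLaw _ _) = _
  rw [deviator_update _ _ hb, lintegral_coinLaw _ _ (φ := fun U => coinRatio Δ i U ^ 2)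
    ((measurable_coinRatio Δ i).pow_const 2), hardPayoffs_some_self]
  simp only [coinRatio, Function.update_self, if_true, zero_ne_one, if_false]
  rw [← ENNReal.ofReal_pow (by linarith), ← ENNReal.ofReal_pow (by linarith),
    ← ENNReal.ofReal_mul (by norm_num), ← ENNReal.ofReal_mul (by norm_num),
    ← ENNReal.ofReal_add (by positivity) (by positivity)]
  congr 1
  ring

end HardGames

/-! ### Proof of the lower bound -/

lemma successProb_eq {N : ℕ} {K : Fin N → ℕ} (alg : Algorithm K) (G : BanditGame K) (Δ : ℝ) :
    alg.successProb G Δ = (alg.runLaw G).real (alg.outputs {a | G.RationalizableProfile Δ a}) := rfl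

theorem sample_complexity_lower_bound (N A : ℕ) (hN : 1 ≤ N) (hA : 2 ≤ A) (Δ : ℝ) (h0 : 0 < Δ)
    (h1 : Δ < 1 / 10) :
    ∃ F : Set (BanditGame (fun _ : Fin N => A)),
      (∀ G ∈ F, G.elimLength Δ ≤ 2) ∧
      ∃ G₀ ∈ F, ∀ alg : Algorithm (fun _ : Fin N => A),
        (∀ G ∈ F, 0.9 ≤ alg.successProb G Δ) →
          ENNReal.ofReal (1 / 160 * (N * A / Δ ^ 2)) ≤ alg.expectedSamples G₀ := by
  have : NeZero A := ⟨by omega⟩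
  let i₀ : Fin N := ⟨0, hN⟩
  let ι := Fin N × {b : Fin A // b ≠ 0}
  have hne0 : (⟨1, by omega⟩ : Fin A) ≠ 0 := by
    intro h
    have := congrArg Fin.val h
    simp at this
  have : Nonempty ι := ⟨(i₀, ⟨⟨1, by omega⟩, hne0⟩)⟩
  have hcard : (Fintype.card ι : ℝ) ≥ N * A / 2 := by
    have h : Fintype.card ι = N * (A - 1) := by
      simp [ι, Fintype.card_subtype_compl]
    rw [h, Nat.cast_mul, Nat.cast_sub (by omega)]
    have : (2 : ℝ) ≤ A := by exact_mod_cast hA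
    have hN' : (0 : ℝ) ≤ N := by positivity
    push_cast
    nlinarith
  let a : ι → Profile fun _ : Fin N => A := fun p => Function.update (0 : Profile fun _ : Fin N => A) p.1 p.2.1
  have ha : Function.Injective a := by
    rintro ⟨i, b, hb⟩ ⟨j, c, hc⟩ h
    have hij : i = j := by
      rw [← deviator_update i₀ i hb, ← deviator_update i₀ j hc]
      exact congrArg _ h
    subst hij
    have := congrFun h i
    simp only [a, Function.update_self] at this
    subst this
    rfl
  let F : Set (BanditGame (fun _ : Fin N => A)) :=
    {G | ∃ s : Option (Fin N × Fin A), (∀ p ∈ s, p.2 ≠ 0) ∧ G = hardGame i₀ h0 h1 s}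
  have hsome : ∀ p : ι, ∀ q ∈ some (p.1, p.2.1), q.2 ≠ 0 := by
    rintro p q hq
    obtain rfl := Option.some.inj hq
    exact p.2.2
  have hnone : ∀ q ∈ (none : Option (Fin N × Fin A)), q.2 ≠ 0 := by simp
  refine ⟨F, ?_, hardGame i₀ h0 h1 none, ⟨none, hnone, rfl⟩, fun alg halg => ?_⟩
  · rintro G ⟨s, hs, rfl⟩
    exact (hardGame_spec i₀ h0 h1 s hs).1
  have hsucc : ∀ s : Option (Fin N × Fin A), (∀ p ∈ s, p.2 ≠ 0) →
      0.9 ≤ (alg.runLaw (hardGame i₀ h0 h1 s)).real (alg.outputs {hardProfile s}) := by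
    intro s hs
    have h := halg _ ⟨s, hs, rfl⟩
    rw [successProb_eq] at h
    have he : {b | (hardGame i₀ h0 h1 s).RationalizableProfile Δ b} = {hardProfile s} := by
      ext b; exact (hardGame_spec i₀ h0 h1 s hs).2 b
    rwa [he] at h
  -- Chosen so that the second moment after `k` plays, `(1 + 16Δ²) ^ k`, is at most `e ≤ 4`.
  set k := ⌊1 / (16 * Δ ^ 2)⌋₊ with hk
  have hkle : (k : ℝ) ≤ 1 / (16 * Δ ^ 2) := Nat.floor_le (by positivity)
  have hklt : 1 / (16 * Δ ^ 2) < (k + 1 : ℕ) := by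
    push_cast; exact Nat.lt_floor_add_one _
  have hpow : ENNReal.ofReal (1 + 16 * Δ ^ 2) ^ k ≤ 4 := by
    rw [← ENNReal.ofReal_pow (by positivity), ← ENNReal.ofReal_ofNat 4]
    refine ENNReal.ofReal_le_ofReal ?_
    calc (1 + 16 * Δ ^ 2) ^ k ≤ (Real.exp (16 * Δ ^ 2)) ^ k := by
          gcongr
          linarith [Real.add_one_le_exp (16 * Δ ^ 2)]
      _ = Real.exp (k * (16 * Δ ^ 2)) := by rw [← Real.exp_nat_mul]
      _ ≤ Real.exp 1 := by
          gcongr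
          rwa [← le_div_iff₀ (by positivity)]
      _ ≤ 4 := by linarith [Real.exp_one_lt_d9]
  -- Outputting the zero profile has probability at least `0.9` in the base game and at most `0.1`
  -- in the alternative. Doing so in the base game after at most `k` plays of `a p` has probability
  -- at most `2 * 0.1 + 4 / 8 = 0.7`, which leaves `0.2` for more plays.
  have hq : ∀ p : ι, ENNReal.ofReal (1 / 5) ≤ alg.runLaw (hardGame i₀ h0 h1 none)
      {ω | ∃ n, alg.StopsAt ω n ∧ k + 1 ≤ Algorithm.playCount (a p) (alg.seedHist ω n).2} := by
    intro p
    set G₀ := hardGame i₀ h0 h1 (none : Option (Fin N × Fin A))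
    set G₁ := hardGame i₀ h0 h1 (some (p.1, p.2.1))
    have hB := alg.measure_outputs_playCount_le G₀ G₁ (a p) (measurable_coinRatio Δ p.1)
      (r := ENNReal.ofReal (1 + 16 * Δ ^ 2)) (by
        rw [← ENNReal.ofReal_one]
        exact ENNReal.ofReal_le_ofReal (by nlinarith)) ENNReal.ofReal_ne_top
      (hardGame_law_of_ne i₀ h0 h1 p.1 p.2.1)
      (fun φ hφ => lintegral_hardGame_none i₀ h0 h1 p.1 p.2.2 hφ)
      (lintegral_coinRatio_sq i₀ h0 h1 p.1 p.2.2).le {hardProfile none} k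
    have hP1 : (alg.runLaw G₁).real (alg.outputs {hardProfile none}) ≤ 0.1 := by
      have hs := hsucc (some (p.1, p.2.1)) (hsome p)
      have hdisj : Disjoint (alg.outputs {hardProfile (none : Option (Fin N × Fin A))})
          (alg.outputs {hardProfile (some (p.1, p.2.1))}) := by
        rw [Set.disjoint_left]
        rintro ω ⟨m, hm, hm'⟩ ⟨n, hn, hn'⟩
        obtain rfl := hm.unique hn
        have h := hm'.symm.trans hn'
        have := congrFun h p.1
        simp only [hardProfile, Option.elim, Function.update_self] at this
        exact p.2.2 this.symm
      have := measureReal_union (μ := alg.runLaw G₁) hdisj (alg.measurableSet_outputs _)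
      have h1 := measureReal_le_one (μ := alg.runLaw G₁)
        (s := alg.outputs {hardProfile none} ∪ alg.outputs {hardProfile (some (p.1, p.2.1))})
      linarith
    have hP0 := hsucc none hnone
    set B := {ω | ∃ n, alg.StopsAt ω n ∧ alg.recommend n (alg.seedHist ω n) ∈
      ({hardProfile none} : Set (Profile fun _ : Fin N => A)) ∧
      Algorithm.playCount (a p) (alg.seedHist ω n).2 ≤ k}
    have hBr : (alg.runLaw G₀).real B ≤ 0.7 := by
      have : alg.runLaw G₀ B ≤ ENNReal.ofReal 0.7 := by
        calc alg.runLaw G₀ B ≤ _ := hB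
          _ ≤ 2 * ENNReal.ofReal 0.1 + 4 / 8 := by
            gcongr
            rw [← ofReal_measureReal]
            exact ENNReal.ofReal_le_ofReal hP1
          _ = ENNReal.ofReal 0.7 := by
            rw [show (4 / 8 : ℝ≥0∞) = ENNReal.ofReal (4 / 8) by
              rw [ENNReal.ofReal_div_of_pos (by norm_num)]; simp, ← ENNReal.ofReal_ofNat 2,
              ← ENNReal.ofReal_mul (by norm_num), ← ENNReal.ofReal_add (by norm_num) (by norm_num)]
            norm_num
      exact ENNReal.toReal_le_of_le_ofReal (by norm_num) this
    set Q := {ω | ∃ n, alg.StopsAt ω n ∧ k + 1 ≤ Algorithm.playCount (a p) (alg.seedHist ω n).2}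
    have hsub : alg.outputs {hardProfile none} ⊆ B ∪ Q := by
      rintro ω ⟨n, hn, hn'⟩
      rcases Nat.lt_or_ge k (Algorithm.playCount (a p) (alg.seedHist ω n).2) with h | h
      · exact Or.inr ⟨n, hn, h⟩
      · exact Or.inl ⟨n, hn, hn', h⟩
    have h3 : (alg.runLaw G₀).real (alg.outputs {hardProfile none}) ≤
        (alg.runLaw G₀).real B + (alg.runLaw G₀).real Q :=
      (measureReal_mono hsub).trans (measureReal_union_le _ _)
    rw [← ofReal_measureReal]
    exact ENNReal.ofReal_le_ofReal (by norm_num at *; linarith)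
  refine le_trans ?_ (alg.le_expectedSamples (hardGame i₀ h0 h1 none) ha (k + 1) _ hq)
  rw [← ENNReal.ofReal_natCast, ← ENNReal.ofReal_natCast, ← ENNReal.ofReal_mul (by positivity),
    ← ENNReal.ofReal_mul (by positivity)]
  refine ENNReal.ofReal_le_ofReal ?_
  calc 1 / 160 * (N * A / Δ ^ 2) = (N * A / 2 : ℝ) * (1 / (16 * Δ ^ 2) * (1 / 5)) := by
        field_simp; norm_num
    _ ≤ _ := by gcongr

/-! ### Measurable choice of a maximizer -/

section Argmax

variable {k : ℕ} [NeZero k]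

lemma exists_forall_le_apply (v : Fin k → ℝ) :
    (Finset.univ.filter fun c => ∀ c', v c' ≤ v c).Nonempty := by
  obtain ⟨c, -, hc⟩ := Finset.exists_max_image Finset.univ v Finset.univ_nonempty
  exact ⟨c, by simpa using hc⟩

/-- The smallest maximizer. -/
noncomputable def argmax (v : Fin k → ℝ) : Fin k :=
  (Finset.univ.filter fun c => ∀ c', v c' ≤ v c).min' (exists_forall_le_apply v)

lemma le_argmax (v : Fin k → ℝ) (c : Fin k) : v c ≤ v (argmax v) :=
  (Finset.mem_filter.1 (Finset.min'_mem _ (exists_forall_le_apply v))).2 c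

/-- Breaking ties by the smallest index makes each fibre a finite Boolean combination of comparisons
between coordinates. -/
lemma measurable_argmax : Measurable (argmax (k := k)) := by
  refine measurable_to_countable' fun c => ?_
  have : argmax ⁻¹' {c} = {v : Fin k → ℝ | (∀ c', v c' ≤ v c) ∧
      ∀ b, (∀ c', v c' ≤ v b) → c ≤ b} := by
    ext v
    simp [argmax, Finset.min'_eq_iff]
  rw [this]
  have hm : ∀ b : Fin k, MeasurableSet {v : Fin k → ℝ | ∀ c', v c' ≤ v b} := fun b => by
    simp only [Set.ofPred_forall]
    exact .iInter fun c' => measurableSet_le (measurable_pi_apply c') (measurable_pi_apply b)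
  have hc : {v : Fin k → ℝ | ∀ b, (∀ c', v c' ≤ v b) → c ≤ b} =
      ⋂ b, {v : Fin k → ℝ | (∀ c', v c' ≤ v b) → c ≤ b} := by
    ext v; simp
  refine (hm c).inter ?_
  change MeasurableSet {v : Fin k → ℝ | ∀ b, (∀ c', v c' ≤ v b) → c ≤ b}
  rw [hc]
  refine .iInter fun b => ?_
  by_cases hcb : c ≤ b
  · simp [hcb]
  · simp only [hcb, imp_false]
    exact (hm b).compl

end Argmax

/-! ### Observed feedback and adaptive Hoeffding bound -/

namespace Algorithm

variable {N : ℕ} {K : Fin N → ℕ}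

section Observations

variable (alg : Algorithm K) (ω : alg.Seed × FeedbackTable K)

/-- The profile that is played in round `t`. -/
def played (t : ℕ) : Profile K := alg.sample t (alg.seedHist ω t)

/-- The feedback that is observed in round `t`. -/
def observed (t : ℕ) : Payoffs N := ω.2 t (alg.played ω t)

lemma seedHist_apply (n : ℕ) (t : Fin n) :
    (alg.seedHist ω n).2 t = (alg.played ω t, alg.observed ω t) := by
  induction n with
  | zero => exact t.elim0
  | succ n ih =>
    rw [seedHist_succ]
    refine Fin.lastCases ?_ (fun j => ?_) t
    · simp [played, observed]
    · simp [ih]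

/-- Extends the feedback observed so far to a sequence. -/
noncomputable def extendFeedback {n : ℕ} (h : Hist K n) (t : ℕ) : Payoffs N :=
  if ht : t < n then (h ⟨t, ht⟩).2 else fun _ => 0

lemma measurable_extendFeedback (n : ℕ) :
    Measurable (extendFeedback : Hist K n → ℕ → Payoffs N) := by
  refine measurable_pi_iff.2 fun t => ?_
  by_cases ht : t < n
  · simp only [extendFeedback, ht, dif_pos]
    exact measurable_snd.comp (measurable_pi_apply _)
  · simp only [extendFeedback, ht, dif_neg, not_false_eq_true]
    exact measurable_const

lemma extendFeedback_seedHist {n t : ℕ} (ht : t < n) :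
    extendFeedback (alg.seedHist ω n).2 t = alg.observed ω t := by
  rw [extendFeedback, dif_pos ht, seedHist_apply]

end Observations

section Concentration

variable (alg : Algorithm K) (G : BanditGame K)

/-- Hoeffding's lemma for a variable in `[0, 1]`, normalized as a weight of mean at most `1` for
optional stopping. -/
lemma lintegral_exp_law_le (i : Fin N) (a : Profile K) (c : ℝ) :
    ∫⁻ U, ENNReal.ofReal (Real.exp (c * ((U i : ℝ) - G.u i a) - c ^ 2 / 8)) ∂(G.law a) ≤ 1 := by
  have hm : Measurable fun U : Payoffs N => ((U i : Set.Icc (0 : ℝ) 1) : ℝ) :=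
    measurable_subtype_coe.comp (measurable_pi_apply i)
  have hsub := hasSubgaussianMGF_of_mem_Icc (μ := G.law a) (a := 0) (b := 1) hm.aemeasurable
    (ae_of_all _ fun U => (U i).2)
  rw [G.mean_law] at hsub
  have hint := hsub.integrable_exp_mul c
  have hle := hsub.mgf_le c
  simp only [Real.exp_sub]
  rw [← ofReal_integral_eq_lintegral_ofReal (hint.div_const _) (ae_of_all _ fun U => by positivity),
    ← ENNReal.ofReal_one]
  refine ENNReal.ofReal_le_ofReal ?_
  rw [integral_div, div_le_one (Real.exp_pos _)]
  refine hle.trans_eq ?_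
  norm_num
  ring

lemma lintegral_histProd_le {T : ℕ} (hT : ∀ ω, alg.StopsAt ω T)
    {g : ℕ → Profile K × Payoffs N → ℝ≥0∞} (hgm : ∀ n, Measurable (g n))
    (hg : ∀ n a, ∫⁻ U, g n (a, U) ∂(G.law a) ≤ 1) :
    ∫⁻ ω, histProd g T (alg.seedHist ω T).2 ∂(alg.runLaw G) ≤ 1 := by
  refine le_trans (le_of_eq_of_le ?_ (ENNReal.le_tsum T)) (alg.tsum_lintegral_histProd_le G hgm hg)
  refine lintegral_congr fun ω => ?_
  rw [Set.indicator_of_mem ((alg.stopsAt_iff ω T).1 (hT ω))]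

/-- Hoeffding's inequality for the feedback that an adaptive algorithm observes in `M` consecutive
rounds. -/
lemma measure_le_sum_observed (i : Fin N) {T t₀ M : ℕ} (hT : ∀ ω, alg.StopsAt ω T)
    (hM : t₀ + M ≤ T) {Δ : ℝ} (c : ℝ) (hc : c ^ 2 = 4 * Δ ^ 2) :
    alg.runLaw G {ω | M * Δ ^ 2 ≤ c * ∑ m ∈ Finset.range M,
      ((alg.observed ω (t₀ + m) i : ℝ) - G.u i (alg.played ω (t₀ + m)))} ≤
      ENNReal.ofReal (Real.exp (-(M * Δ ^ 2 / 2))) := by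
  -- The exponential weight is active only in the window of `M` rounds. With `c = ±2Δ`, the optimal
  -- tilt for a deviation of `MΔ/2`, the compensator `c² / 8` totals `MΔ²/2`, and Markov's
  -- inequality yields the bound.
  set g : ℕ → Profile K × Payoffs N → ℝ≥0∞ := fun t x =>
    if t ∈ Finset.Ico t₀ (t₀ + M) then
      ENNReal.ofReal (Real.exp (c * ((x.2 i : ℝ) - G.u i x.1) - c ^ 2 / 8)) else 1 with hgdef
  have hu : Measurable fun x : Profile K × Payoffs N => G.u i x.1 :=
    (measurable_of_countable (G.u i)).comp measurable_fst
  have hX : Measurable fun x : Profile K × Payoffs N => ((x.2 i : Set.Icc (0 : ℝ) 1) : ℝ) :=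
    measurable_subtype_coe.comp ((measurable_pi_apply i).comp measurable_snd)
  have hgm : ∀ n, Measurable (g n) := fun n => by
    by_cases hn : n ∈ Finset.Ico t₀ (t₀ + M)
    · simp only [hgdef, hn, if_true]
      fun_prop
    · simp only [hgdef, hn, if_false]
      fun_prop
  have hg : ∀ n a, ∫⁻ U, g n (a, U) ∂(G.law a) ≤ 1 := fun n a => by
    by_cases hn : n ∈ Finset.Ico t₀ (t₀ + M)
    · simp only [hgdef, hn, if_true]
      exact lintegral_exp_law_le G i a c
    · simp only [hgdef, hn, if_false, lintegral_one, measure_univ, le_refl]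
  have hprod : ∀ ω, histProd g T (alg.seedHist ω T).2 =
      ENNReal.ofReal (Real.exp (c * ∑ m ∈ Finset.range M,
        ((alg.observed ω (t₀ + m) i : ℝ) - G.u i (alg.played ω (t₀ + m))) - M * Δ ^ 2 / 2)) := by
    intro ω
    simp only [histProd, seedHist_apply]
    rw [Fin.prod_univ_eq_prod_range (fun t => g t (alg.played ω t, alg.observed ω t)) T]
    simp only [hgdef]
    rw [Finset.prod_ite_mem, Finset.inter_eq_right.2 (fun t ht => by
      rw [Finset.mem_Ico] at ht; rw [Finset.mem_range]; omega),
      ← ENNReal.ofReal_prod_of_nonneg (fun _ _ => by positivity), ← Real.exp_sum,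
      Finset.sum_Ico_eq_sum_range, Nat.add_sub_cancel_left, Finset.sum_sub_distrib,
      ← Finset.mul_sum]
    congr 3
    simp [hc]
    ring
  have hint := alg.lintegral_histProd_le G hT hgm hg
  simp only [hprod] at hint
  have hmeas : Measurable fun ω => ENNReal.ofReal (Real.exp (c * ∑ m ∈ Finset.range M,
        ((alg.observed ω (t₀ + m) i : ℝ) - G.u i (alg.played ω (t₀ + m))) - M * Δ ^ 2 / 2)) := by
    simp only [← hprod]
    exact (measurable_histProd hgm T).comp (measurable_snd.comp (alg.measurable_seedHist T))
  calc _ ≤ alg.runLaw G {ω | ENNReal.ofReal (Real.exp (M * Δ ^ 2 / 2)) ≤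
        ENNReal.ofReal (Real.exp (c * ∑ m ∈ Finset.range M,
          ((alg.observed ω (t₀ + m) i : ℝ) - G.u i (alg.played ω (t₀ + m))) - M * Δ ^ 2 / 2))} := by
        refine measure_mono fun ω hω => ENNReal.ofReal_le_ofReal (Real.exp_le_exp.2 ?_)
        have : M * Δ ^ 2 ≤ _ := hω
        linarith
    _ ≤ 1 / ENNReal.ofReal (Real.exp (M * Δ ^ 2 / 2)) := by
        rw [ENNReal.le_div_iff_mul_le (by simp [Real.exp_pos]) (by simp), mul_comm]
        exact (mul_meas_ge_le_lintegral hmeas _).trans hint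
    _ = _ := by
        rw [Real.exp_neg, ENNReal.ofReal_inv_of_pos (Real.exp_pos _), one_div]

end Concentration

/-! ### Iterated best response -/

section IteratedBestResponse

/-- Round `(l * S + s) * M + m` is repetition `m` of action number `s` in stage `l`, all counted
from zero; stage `l` ends before round `(l + 1) * S * M`. -/
lemma index_lt {S M l s m : ℕ} (hs : s < S) (hm : m < M) :
    (l * S + s) * M + m < (l + 1) * S * M := by
  calc (l * S + s) * M + m < (l * S + s + 1) * M := by rw [add_one_mul]; omega
    _ ≤ (l + 1) * S * M := by gcongr; rw [add_one_mul]; omega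

variable [∀ i, NeZero (K i)] (M S L : ℕ) (act : ℕ → Σ i, Fin (K i)) (idx : (Σ i, Fin (K i)) → ℕ)

/-- The profile of empirical best responses in the stage before `l`. The payoff of the action `p` is
sampled `M` times in each stage, and `S` actions are sampled one after the other. -/
noncomputable def bestResponse (y : ℕ → Payoffs N) : ℕ → Profile K
  -- Any starting profile would do, since `E_0` is empty.
  | 0 => fun _ => 0
  | l + 1 => fun i => argmax fun b =>
      ∑ m ∈ Finset.range M, (y ((l * S + idx ⟨i, b⟩) * M + m) i : ℝ)

/-- The responses used in stage `l` read only earlier stages, so the zeros by which a finite history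
is extended never matter. -/
lemma bestResponse_congr (hidx : ∀ p, idx p < S) {y z : ℕ → Payoffs N} {l : ℕ}
    (h : ∀ t < l * S * M, y t = z t) :
    bestResponse M S idx y l = bestResponse M S idx z l := by
  cases l with
  | zero => rfl
  | succ l =>
    funext i
    simp only [bestResponse]
    congr 1
    funext b
    refine Finset.sum_congr rfl fun m hm => ?_
    rw [h _ (index_lt (hidx _) (Finset.mem_range.1 hm))]

lemma measurable_bestResponse (l : ℕ) :
    Measurable fun y : ℕ → Payoffs N => bestResponse M S idx y l := by
  cases l with
  | zero => exact measurable_const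
  | succ l =>
    refine measurable_pi_iff.2 fun i => measurable_argmax.comp (measurable_pi_iff.2 fun b => ?_)
    refine Finset.measurable_sum _ fun m _ => measurable_subtype_coe.comp ?_
    exact (measurable_pi_apply i).comp (measurable_pi_apply _)

/-- Iterated best response: in each of `L` stages, every action of every player is played `M` times
against the profile of the empirical best responses of the previous stage. -/
noncomputable def iteratedBestResponse : Algorithm K where
  Seed := Unit
  seedLaw := Measure.dirac ()
  sample n x := Function.update (bestResponse M S idx (extendFeedback x.2) (n / M / S))
    (act (n / M % S)).1 (act (n / M % S)).2
  halt n := {_x | n = L * S * M}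
  recommend _ x := bestResponse M S idx (extendFeedback x.2) L
  measurable_sample n := (measurable_of_countable fun a : Profile K =>
    Function.update a (act (n / M % S)).1 (act (n / M % S)).2).comp
      ((measurable_bestResponse M S idx _).comp ((measurable_extendFeedback n).comp measurable_snd))
  measurableSet_halt _ := .const _
  measurable_recommend n :=
    (measurable_bestResponse M S idx _).comp ((measurable_extendFeedback n).comp measurable_snd)

lemma stopsAt_iteratedBestResponse (ω) :
    (iteratedBestResponse M S L act idx).StopsAt ω (L * S * M) :=
  ⟨rfl, fun _ hm h => hm.ne h⟩

lemma played_iteratedBestResponse (hidx : ∀ p, idx p < S) (hact : ∀ p, act (idx p) = p) (ω)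
    {l m : ℕ} (p : Σ i, Fin (K i)) (hm : m < M) :
    (iteratedBestResponse M S L act idx).played ω ((l * S + idx p) * M + m) =
      Function.update (bestResponse M S idx
        ((iteratedBestResponse M S L act idx).observed ω) l) p.1 p.2 := by
  have h1 : ((l * S + idx p) * M + m) / M = l * S + idx p := by
    rw [mul_comm, Nat.mul_add_div (by omega), Nat.div_eq_of_lt hm, add_zero]
  have h2 : (l * S + idx p) / S = l := by
    rw [mul_comm, Nat.mul_add_div ((Nat.zero_le _).trans_lt (hidx p)), Nat.div_eq_of_lt (hidx p),
      add_zero]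
  have h3 : (l * S + idx p) % S = idx p := by
    rw [mul_comm, Nat.mul_add_mod, Nat.mod_eq_of_lt (hidx p)]
  change Function.update (bestResponse M S idx (extendFeedback _) _) _ _ = _
  rw [h1, h2, h3, hact]
  congr 1
  refine bestResponse_congr M S idx hidx fun t ht => extendFeedback_seedHist _ _ ?_
  refine ht.trans_le ?_
  calc l * S * M ≤ (l * S + idx p) * M := by gcongr; omega
    _ ≤ _ := by omega

/-- If all estimates of stage `l` are accurate, the empirical best responses are almost best
responses. -/
lemma sub_lt_bestResponse (G : Game K) {Δ : ℝ} (hM : 0 < M) {y : ℕ → Payoffs N} {l : ℕ} {i : Fin N}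
    {a : Profile K}
    (h : ∀ b, |∑ m ∈ Finset.range M, (y ((l * S + idx ⟨i, b⟩) * M + m) i : ℝ) -
      M * G.u i (Function.update a i b)| < M * Δ / 2) (c : Fin (K i)) :
    G.u i (Function.update a i c) - Δ <
      G.u i (Function.update a i (bestResponse M S idx y (l + 1) i)) := by
  have h1 := le_argmax (fun b => ∑ m ∈ Finset.range M, (y ((l * S + idx ⟨i, b⟩) * M + m) i : ℝ)) c
  have h2 := (abs_lt.1 (h c)).1
  have h3 := (abs_lt.1 (h (bestResponse M S idx y (l + 1) i))).2
  have hM' : (0 : ℝ) < M := by exact_mod_cast hM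
  refine lt_of_mul_lt_mul_left ?_ hM'.le
  simp only [bestResponse] at h3 ⊢
  linarith

/-- Each stage gains one round of elimination: a response that loses less than `Δ` against a profile
avoiding `E_l` avoids `E_{l+1}`. -/
lemma bestResponse_notMem_elim (G : Game K) {Δ : ℝ} {y : ℕ → Payoffs N}
    (h : ∀ l < L, ∀ i c, G.u i (Function.update (bestResponse M S idx y l) i c) - Δ <
      G.u i (Function.update (bestResponse M S idx y l) i (bestResponse M S idx y (l + 1) i))) :
    ∀ l ≤ L, ∀ j, (⟨j, bestResponse M S idx y l j⟩ : Σ i, Fin (K i)) ∉ G.elim Δ l := by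
  intro l
  induction l with
  | zero => exact fun _ _ hj => hj
  | succ l ih => exact fun hl j => G.notMem_elim_succ (ih (by omega)) (h l hl j)

lemma mem_outputs_iteratedBestResponse (hidx : ∀ p, idx p < S) (G : Game K) {Δ : ℝ}
    (hL : G.elimLength Δ ≤ L) (ω)
    (h : ∀ l < L, ∀ i c, G.u i (Function.update (bestResponse M S idx
      ((iteratedBestResponse M S L act idx).observed ω) l) i c) - Δ <
      G.u i (Function.update (bestResponse M S idx
        ((iteratedBestResponse M S L act idx).observed ω) l) i
        (bestResponse M S idx ((iteratedBestResponse M S L act idx).observed ω) (l + 1) i))) :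
    ω ∈ (iteratedBestResponse M S L act idx).outputs {a | G.RationalizableProfile Δ a} := by
  refine ⟨L * S * M, stopsAt_iteratedBestResponse M S L act idx ω, fun j => ?_⟩
  rw [← G.elim_of_elimLength_le Δ hL]
  have : (iteratedBestResponse M S L act idx).recommend (L * S * M)
      ((iteratedBestResponse M S L act idx).seedHist ω (L * S * M)) =
      bestResponse M S idx ((iteratedBestResponse M S L act idx).observed ω) L :=
    bestResponse_congr M S idx hidx fun t ht => extendFeedback_seedHist _ _ ht
  rw [this]
  exact bestResponse_notMem_elim M S L idx G h L le_rfl j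

/-- A union bound over stages, actions and the sign of the error, which accounts for the factor `2`.
Off the bad events every empirical sum is within `MΔ/2` of its target, so comparing two of them
costs less than `MΔ`. -/
lemma successProb_iteratedBestResponse (hM : 0 < M) (hidx : ∀ p, idx p < S)
    (hact : ∀ p, act (idx p) = p) (G : BanditGame K) {Δ : ℝ} (hΔ : 0 < Δ)
    (hL : G.elimLength Δ ≤ L) :
    1 - 2 * L * Fintype.card (Σ i, Fin (K i)) * Real.exp (-(M * Δ ^ 2 / 2)) ≤
      (iteratedBestResponse M S L act idx).successProb G Δ := by
  set alg := iteratedBestResponse M S L act idx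
  set B : Fin L × (Σ i, Fin (K i)) × Bool → Set (alg.Seed × FeedbackTable K) := fun q =>
    {ω | M * Δ ^ 2 ≤ (if q.2.2 then 2 * Δ else -(2 * Δ)) * ∑ m ∈ Finset.range M,
      ((alg.observed ω ((q.1 * S + idx q.2.1) * M + m) q.2.1.1 : ℝ) -
        G.u q.2.1.1 (alg.played ω ((q.1 * S + idx q.2.1) * M + m)))} with hB
  have hPB : ∀ q, (alg.runLaw G).real (B q) ≤ Real.exp (-(M * Δ ^ 2 / 2)) := fun q => by
    refine ENNReal.toReal_le_of_le_ofReal (Real.exp_pos _).le ?_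
    refine alg.measure_le_sum_observed G q.2.1.1
      (stopsAt_iteratedBestResponse M S L act idx) ?_ _ ?_
    · calc (q.1 * S + idx q.2.1) * M + M = (q.1 * S + idx q.2.1 + 1) * M := by ring
        _ ≤ L * S * M := by
          have h1 := hidx q.2.1
          have h2 : (q.1 + 1) * S ≤ L * S := Nat.mul_le_mul_right S q.1.2
          rw [add_one_mul] at h2
          exact Nat.mul_le_mul_right M (by omega)
    · split_ifs <;> ring
  have hcover : Set.univ ⊆ alg.outputs {a | G.RationalizableProfile Δ a} ∪ ⋃ q, B q := by
    intro ω _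
    by_cases hω : ω ∈ ⋃ q, B q
    · exact Or.inr hω
    refine Or.inl (mem_outputs_iteratedBestResponse M S L act idx hidx G.toGame hL ω ?_)
    intro l hl i
    refine sub_lt_bestResponse M S idx G.toGame hM fun b => ?_
    have hb : ∀ σ, ω ∉ B (⟨l, hl⟩, ⟨i, b⟩, σ) := fun σ h => hω (Set.mem_iUnion.2 ⟨_, h⟩)
    have hsum : ∑ m ∈ Finset.range M, ((alg.observed ω ((l * S + idx ⟨i, b⟩) * M + m) i : ℝ) -
        G.u i (alg.played ω ((l * S + idx ⟨i, b⟩) * M + m))) =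
        ∑ m ∈ Finset.range M, (alg.observed ω ((l * S + idx ⟨i, b⟩) * M + m) i : ℝ) -
          M * G.u i (Function.update (bestResponse M S idx (alg.observed ω) l) i b) := by
      rw [Finset.sum_sub_distrib]
      congr 1
      rw [Finset.sum_congr rfl fun m hm => by
        rw [played_iteratedBestResponse M S L act idx hidx hact ω ⟨i, b⟩ (Finset.mem_range.1 hm)]]
      simp only [Finset.sum_const, Finset.card_range, nsmul_eq_mul]
      rfl
    have h1 := hb true
    have h2 := hb false
    simp only [hB, Set.mem_ofPred_eq, not_le, hsum, if_true, Bool.false_eq_true, if_false] at h1 h2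
    rw [abs_lt]
    constructor
    · refine lt_of_mul_lt_mul_left ?_ (by linarith : (0 : ℝ) ≤ 2 * Δ)
      nlinarith
    · refine lt_of_mul_lt_mul_left ?_ (by linarith : (0 : ℝ) ≤ 2 * Δ)
      nlinarith
  have h1 : 1 ≤ (alg.runLaw G).real (alg.outputs {a | G.RationalizableProfile Δ a}) +
      (alg.runLaw G).real (⋃ q, B q) := by
    refine (probReal_univ (μ := alg.runLaw G)).symm.le.trans ?_
    exact (measureReal_mono hcover).trans (measureReal_union_le _ _)
  have h2 : (alg.runLaw G).real (⋃ q, B q) ≤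
      2 * L * Fintype.card (Σ i, Fin (K i)) * Real.exp (-(M * Δ ^ 2 / 2)) := by
    refine (measureReal_iUnion_fintype_le _).trans
      ((Finset.sum_le_sum fun q _ => hPB q).trans_eq ?_)
    simp only [Finset.sum_const, Finset.card_univ, Fintype.card_prod, Fintype.card_fin,
      Fintype.card_bool, nsmul_eq_mul]
    push_cast
    ring
  rw [successProb_eq]
  linarith

end IteratedBestResponse

end Algorithm

/-! ### Choice of parameters for the upper bound -/

theorem sample_complexity_upper_bound {N A L : ℕ} {K : Fin N → ℕ} (hN : 1 ≤ N)
    (hK : ∀ i, 1 ≤ K i ∧ K i ≤ A) (hL : 1 ≤ L) {Δ δ : ℝ} (hΔ : 0 < Δ) (hδ0 : 0 < δ) (hδ1 : δ < 1) :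
    ∃ alg : Algorithm K,
      (∀ ω, alg.numSamples ω ≤
        ENNReal.ofReal (4 * (L * N * A / Δ ^ 2) * Real.log (2 * L * N * A / δ))) ∧
      ∀ G : BanditGame K, G.elimLength Δ ≤ L → 1 - δ ≤ alg.successProb G Δ := by
  have : ∀ i, NeZero (K i) := fun i => ⟨by have := (hK i).1; omega⟩
  have : Nonempty (Σ i, Fin (K i)) := ⟨⟨⟨0, hN⟩, 0⟩⟩
  have hA : 1 ≤ A := (hK ⟨0, hN⟩).1.trans (hK ⟨0, hN⟩).2
  set S := Fintype.card (Σ i, Fin (K i)) with hS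
  have hSle : (S : ℝ) ≤ N * A := by
    have : S ≤ N * A := by
      rw [hS, Fintype.card_sigma]
      calc ∑ i, Fintype.card (Fin (K i)) ≤ ∑ _i : Fin N, A :=
            Finset.sum_le_sum fun i _ => by rw [Fintype.card_fin]; exact (hK i).2
        _ = N * A := by simp
    exact_mod_cast this
  let e := Fintype.equivFin (Σ i, Fin (K i))
  let idx : (Σ i, Fin (K i)) → ℕ := fun p => e p
  have hidx : ∀ p, idx p < S := fun p => (e p).2
  have hinj : Function.Injective idx := fun p q h => e.injective (Fin.ext h)
  let act : ℕ → Σ i, Fin (K i) := Function.invFun idx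
  have hact : ∀ p, act (idx p) = p := Function.leftInverse_invFun hinj
  have hLNA : (1 : ℝ) ≤ L * N * A := by
    have : 1 ≤ L * N * A := Nat.mul_pos (Nat.mul_pos hL hN) hA
    exact_mod_cast this
  set X : ℝ := 2 * L * N * A / δ with hX
  have hX2 : 2 ≤ X := by
    rw [hX, le_div_iff₀ hδ0]
    nlinarith
  have hlog : 1 / 2 ≤ Real.log X := by
    have := Real.log_two_gt_d9
    have := Real.log_le_log (by norm_num) hX2
    linarith
  rcases le_or_gt Δ 1 with hΔ1 | hΔ1
  -- This gives `exp (-MΔ²/2) ≤ 1/X`, so the union bound totals at most `δ`. As `Δ ≤ 1` and `log X ≥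
  -- 1/2`, the quantity rounded up is at least `1`, so rounding at most doubles it.
  · set M := ⌈2 * Real.log X / Δ ^ 2⌉₊ with hM
    have hMpos : 0 < M := Nat.ceil_pos.2 (by positivity)
    have hMge : 2 * Real.log X / Δ ^ 2 ≤ M := Nat.le_ceil _
    have hMle : (M : ℝ) ≤ 4 * Real.log X / Δ ^ 2 := by
      have h1 : (M : ℝ) < 2 * Real.log X / Δ ^ 2 + 1 := Nat.ceil_lt_add_one (by positivity)
      have h2 : 1 ≤ 2 * Real.log X / Δ ^ 2 := by
        rw [le_div_iff₀ (by positivity)]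
        nlinarith
      have h3 : 4 * Real.log X / Δ ^ 2 = 2 * Real.log X / Δ ^ 2 + 2 * Real.log X / Δ ^ 2 := by ring
      linarith
    refine ⟨Algorithm.iteratedBestResponse M S L act idx, fun ω => ?_, fun G hG => ?_⟩
    · rw [Algorithm.numSamples_eq (Algorithm.stopsAt_iteratedBestResponse M S L act idx ω),
        ← ENNReal.ofReal_natCast]
      refine ENNReal.ofReal_le_ofReal ?_
      push_cast
      calc (L * S * M : ℝ) ≤ L * (N * A) * (4 * Real.log X / Δ ^ 2) := by gcongr
        _ = _ := by ring
    · refine le_trans ?_ (Algorithm.successProb_iteratedBestResponse M S L act idx hMpos hidx hact G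
        hΔ hG)
      have hexp : Real.exp (-(M * Δ ^ 2 / 2)) ≤ X⁻¹ := by
        rw [← Real.exp_log (by positivity : 0 < X⁻¹), Real.log_inv]
        refine Real.exp_le_exp.2 (neg_le_neg ?_)
        rw [div_le_iff₀ (by positivity)] at hMge
        linarith
      have : 2 * L * S * Real.exp (-(M * Δ ^ 2 / 2)) ≤ δ := by
        calc 2 * L * S * Real.exp (-(M * Δ ^ 2 / 2)) ≤ 2 * L * (N * A) * X⁻¹ := by gcongr
          _ = δ := by
            rw [hX]
            field_simp
      linarith
  -- For `Δ > 1` payoffs in `[0, 1]` never differ by `Δ`, so every response is good enough and no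
  -- samples are needed.
  · refine ⟨Algorithm.iteratedBestResponse 0 S L act idx, fun ω => ?_, fun G hG => ?_⟩
    · rw [Algorithm.numSamples_eq (Algorithm.stopsAt_iteratedBestResponse 0 S L act idx ω)]
      simp
    · have : (Algorithm.iteratedBestResponse 0 S L act idx).outputs
          {a | G.RationalizableProfile Δ a} = Set.univ := by
        refine Set.eq_univ_of_forall fun ω => ?_
        refine Algorithm.mem_outputs_iteratedBestResponse 0 S L act idx hidx G.toGame hG ω ?_
        intro l _ i c
        refine lt_of_lt_of_le ?_ (G.u_mem i _).1
        linarith [(G.u_mem i (Function.update (Algorithm.bestResponse 0 S idx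
          ((Algorithm.iteratedBestResponse 0 S L act idx).observed ω) l) i c)).2]
      rw [successProb_eq, this, probReal_univ]
      linarith

/-- First part: the lower bound, already for games of elimination length at most `2`. Second part:
the matching upper bound `O(L N A log (L N A / δ) / Δ ^ 2)`, where `L` bounds the elimination length
and `A` the number of actions of a player. -/
theorem mainTheorem4 :
    (∃ c : ℝ, 0 < c ∧ ∀ N A : ℕ, 1 ≤ N → 2 ≤ A → ∀ Δ : ℝ, 0 < Δ → Δ < 1 / 10 →
      ∃ F : Set (BanditGame (fun _ : Fin N => A)),
        (∀ G ∈ F, G.elimLength Δ ≤ 2) ∧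
        ∃ G₀ ∈ F, ∀ alg : Algorithm (fun _ : Fin N => A),
          (∀ G ∈ F, 0.9 ≤ alg.successProb G Δ) →
            ENNReal.ofReal (c * (N * A / Δ ^ 2)) ≤ alg.expectedSamples G₀) ∧
    (∃ C : ℝ, 0 < C ∧ ∀ (N A L : ℕ) (K : Fin N → ℕ), 1 ≤ N → (∀ i, 1 ≤ K i ∧ K i ≤ A) → 1 ≤ L →
      ∀ Δ δ : ℝ, 0 < Δ → 0 < δ → δ < 1 →
        ∃ alg : Algorithm K,
          (∀ ω, alg.numSamples ω ≤
            ENNReal.ofReal (C * (L * N * A / Δ ^ 2) * Real.log (2 * L * N * A / δ))) ∧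
          ∀ G : BanditGame K, G.elimLength Δ ≤ L → 1 - δ ≤ alg.successProb G Δ) :=
  ⟨⟨1 / 160, by norm_num, fun N A hN hA Δ h0 h1 => sample_complexity_lower_bound N A hN hA Δ h0 h1⟩,
    4, by norm_num, fun _ _ _ _ hN hK hL _ _ hΔ hδ0 hδ1 =>
      sample_complexity_upper_bound hN hK hL hΔ hδ0 hδ1⟩
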